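/- Let $N\ge 1$, and let $K(x)=k(|x|)$ on $\mathbb{R}^N$, where $k\in C^1(0,\infty)$, $k'\in L^\infty(0,\infty)$, the number $\kappa_\Lambda:=-\sup_{s\in(0,\Lambda)}k'(s)$ belongs to $(0,\infty)$ for each $\Lambda>0$, and $\kappa_0:=\lim_{\Lambda\searrow0}\kappa_\Lambda\in(0,\infty)$; if $N=1$, assume moreover that $k''\in L^1(0,\infty)$. Let $u_0\in L^1(\mathbb{R}^N)\cap L^\infty(\mathbb{R}^N)$ be radial and nonnegative with $M:=\int_{\mathbb{R}^N}u_0(x)\,dx>0$, and suppose that there exists $\Lambda>0$ such that $$\int_{\mathbb{R}^N}\min\{|x|,\Lambda\}\,u_0(x)\,dx<\frac{\kappa_\Lambda M}{4\left(\kappa_\Lambda+2\|k'\|_\infty\right)}\,\Lambda .$$ Then there exist $\varepsilon_*>0$, $T_*>0$ and $\lambda>0$ such that for each $p\in[1,\infty)$ there exists $C_{**}(p)>0$, where $\varepsilon_*$, $T_*$, $\lambda$ and $C_{**}(p)$ do not depend on $\varepsilon$ (and $\varepsilon_*$, $T_*$, $\lambda$ do not depend on $p$), with the following property. For every $\varepsilon\in(0,\varepsilon_*)$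 and every radial, nonnegative, global-in-time solution $u$ of $$u_t-\varepsilon\Delta u+\nabla\cdot(u\,\nabla K*u)=0\quad (x\in\mathbb{R}^N,\ t>0),\qquad u(x,0)=u_0(x)\quad (x\in\mathbb{R}^N),$$ one has $$\int_0^{T_*}\left(\int_{B_{\lambda\varepsilon}}u(x,t)^p\,dx\right)^{1/p}dt\ \ge\ C_{**}(p)\,\varepsilon^{-N(p-1)/p},$$ where $B_r$ is the ball of radius $r$ centred at the origin. Here a global-in-time solution is a function $u\in C([0,\infty);L^1(\mathbb{R}^N))$ with $u(0)=u_0$ such that, for all $\varphi\in C_c^\infty(\mathbb{R}^N)$ and $t\ge0$, $$\int_{\mathbb{R}^N} u(x,t)\varphi(x)\,dx=\int_{\mathbb{R}^N} u_0(x)\varphi(x)\,dx+\int_0^t\!\int_{\mathbb{R}^N}u(x,s)\big(\varepsilon\Delta\varphi(x)+(\nabla K*u(s))(x)\cdot\nabla\varphi(x)\big)\,dx\,ds .$$ This class contains the unique mild (and smooth for $t>0$) solution; the left-hand side of the lower bound is understood in $[0,\infty]$. -/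

import Mathlib

open MeasureTheory Set Filter Topology
open scoped ContDiff Gradient Laplacian

noncomputable section

/-- `κ_Λ = - sup_{0 < s < Λ} k'(s)`. -/
def kappa (k : ℝ → ℝ) (Λ : ℝ) : ℝ := -sSup (deriv k '' Ioo 0 Λ)

/-- `‖k'‖_∞ = sup_{s > 0} |k'(s)|` (for continuous `k'` the supremum over `(0, ∞)` is the
essential supremum). -/
def supNormDeriv (k : ℝ → ℝ) : ℝ := sSup ((fun s => |deriv k s|) '' Ioi 0)

/-- The assumptions on the profile `k : (0, ∞) → ℝ` of the radial interaction kernel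
`K(x) = k(|x|)` on `ℝ^N`. The values of `k` outside `(0, ∞)` play no role. -/
structure IsMildlySingularProfile (N : ℕ) (k : ℝ → ℝ) : Prop where
  /-- `k` is continuously differentiable on `(0, ∞)`. -/
  contDiffOn : ContDiffOn ℝ 1 k (Ioi 0)
  /-- `k'` is bounded on `(0, ∞)`. -/
  bddAbove_deriv : BddAbove ((fun s => |deriv k s|) '' Ioi 0)
  /-- `κ_Λ` is positive for each `Λ > 0`. -/
  kappa_pos : ∀ Λ : ℝ, 0 < Λ → 0 < kappa k Λ
  /-- `κ_Λ` has a limit in `(0, ∞)` as `Λ` decreases to `0`. -/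
  kappa_lim : ∃ κ₀ : ℝ, 0 < κ₀ ∧ Tendsto (kappa k) (𝓝[>] 0) (𝓝 κ₀)
  /-- In dimension one, the weak derivative `k''` of `k'` exists and belongs to `L¹(0, ∞)`;
  as `k'` is continuous, this says that `k'` is a primitive of an integrable function. -/
  integrable_deriv2 : N = 1 → ∃ k'' : ℝ → ℝ, IntegrableOn k'' (Ioi 0) ∧
    ∀ a b : ℝ, 0 < a → 0 < b → deriv k b - deriv k a = ∫ s in a..b, k'' s

/-- The radial interaction kernel `K(x) = k(|x|)` on `ℝ^N`. -/
def radialKernel (N : ℕ) (k : ℝ → ℝ) (x : EuclideanSpace ℝ (Fin N)) : ℝ := k ‖x‖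

/-- The velocity field `∇K ∗ v`. -/
def drift {N : ℕ} (K : EuclideanSpace ℝ (Fin N) → ℝ) (v : EuclideanSpace ℝ (Fin N) → ℝ)
    (x : EuclideanSpace ℝ (Fin N)) : EuclideanSpace ℝ (Fin N) :=
  ∫ y, v y • ∇ K (x - y)

/-- A function on `ℝ^N`, considered up to null sets, is radial if it is invariant under all
linear isometries. -/
def IsRadial {N : ℕ} (v : EuclideanSpace ℝ (Fin N) → ℝ) : Prop :=
  ∀ R : EuclideanSpace ℝ (Fin N) ≃ₗᵢ[ℝ] EuclideanSpace ℝ (Fin N),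
    (fun x => v (R x)) =ᵐ[volume] v

/-- `u ∈ C([0, ∞); L¹(ℝ^N))` is a global-in-time (distributional) solution of
`u_t - ε Δu + ∇·(u ∇K ∗ u) = 0`, `u(·, 0) = u₀`. -/
structure IsGlobalSolution {N : ℕ} (ε : ℝ) (K : EuclideanSpace ℝ (Fin N) → ℝ)
    (u₀ : EuclideanSpace ℝ (Fin N) → ℝ) (u : ℝ → EuclideanSpace ℝ (Fin N) → ℝ) : Prop where
  integrable : ∀ t : ℝ, 0 ≤ t → Integrable (u t) volume
  /-- `t ↦ u(t)` is continuous from `[0, ∞)` to `L¹`. -/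
  continuous_L1 : ∀ t : ℝ, 0 ≤ t →
    Tendsto (fun s => ∫ x, |u s x - u t x|) (𝓝[Ici 0] t) (𝓝 0)
  initial : u 0 =ᵐ[volume] u₀
  /-- The equation, tested with `φ ∈ C_c^∞(ℝ^N)` and integrated over `[0, t]`. -/
  equation : ∀ φ : EuclideanSpace ℝ (Fin N) → ℝ, ContDiff ℝ ∞ φ → HasCompactSupport φ →
    ∀ t : ℝ, 0 ≤ t →
      ∫ x, u t x * φ x = (∫ x, u₀ x * φ x) +
        ∫ s in (0 : ℝ)..t, ∫ x, u s x * (ε * Δ φ x + inner ℝ (drift K (u s) x) (∇ φ x))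

end

/-! ### Calculus of radial functions. -/

section RadialCalculus

variable {N : ℕ}

/-! Mass must gather at scale ε, since otherwise a truncated first moment would become negative in
finite time. Write L = ‖k'‖_∞, κ = κ_Λ, and let m(t) = ∫ u w(|x|), where w is a smooth version of
min(r, Λ) that vanishes for r ≤ ε. Then w(Λ) - w(|x|) is an admissible test function, and the
equation expresses the growth of m through a diffusion term and the virial ∫ u (∇K∗u)·a x/|x| with a
= w'.

The virial is averaged over the exchange of x and y and over y ↦ -y; evenness is all that is used of
radial symmetry. If both points lie in B_{Λ/2} and outside B_{λε}, the pairs (x, y) and (x, -y), at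
angles θ and π - θ, contribute at most -κ(1 - cos θ) - κ(1 + cos θ) = -2κ, whatever the angle
(`symmetrized_virial_le`). Every other configuration costs at most 4L. It is paid for by the mass
outside B_{Λ/2}, which m controls by Chebyshev (`mass_outside_ball_le`), or by the mass F(t) in
B_{λε}. Diffusion likewise costs a multiple of F, plus an error that is small for large λ and small
ε (`neg_laplacian_momentTest_le`).

With mass conservation this yields m(t) ≤ m(0) + ∫₀ᵗ (A(m - b) + Aη/4 + C F), where b is the
threshold in the hypothesis and η the gap below it. If ∫₀ᵀ F were less than η/(4C), then m would
stay below b - η/2, decrease at least linearly up to a small error, and be negative at T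
(`le_integral_of_integral_inequality`). So ∫₀ᵀ F is bounded below uniformly in ε, and Hölder on a
ball of volume proportional to ε^N produces the power of ε. -/

theorem hasFDerivAt_comp_norm_sq {V : ℝ → ℝ} {v : ℝ} {x : EuclideanSpace ℝ (Fin N)}
    (h : HasDerivAt V v (‖x‖ ^ 2)) :
    HasFDerivAt (fun y : EuclideanSpace ℝ (Fin N) => V (‖y‖ ^ 2)) ((2 * v) • innerSL ℝ x) x := by
  have h1 : HasFDerivAt (fun y : EuclideanSpace ℝ (Fin N) => ‖y‖ ^ 2) (2 • innerSL ℝ x) x :=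
    (hasStrictFDerivAt_norm_sq x).hasFDerivAt
  refine (h.comp_hasFDerivAt x h1).congr_fderiv ?_
  ext y
  simp
  ring

theorem gradient_comp_norm_sq {V : ℝ → ℝ} {v : ℝ} {x : EuclideanSpace ℝ (Fin N)}
    (h : HasDerivAt V v (‖x‖ ^ 2)) :
    ∇ (fun y : EuclideanSpace ℝ (Fin N) => V (‖y‖ ^ 2)) x = (2 * v) • x := by
  apply HasGradientAt.gradient
  rw [hasGradientAt_iff_hasFDerivAt]
  refine (hasFDerivAt_comp_norm_sq h).congr_fderiv ?_
  ext y
  simp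

/-- The second derivative along e is 4q'⟨e,x⟩² + 2q|e|²; summing over an orthonormal basis uses
Parseval. Taking |x|² rather than |x| as the variable avoids a special case at the origin. -/
theorem laplacian_comp_norm_sq {V q q' : ℝ → ℝ} (hVs : ContDiff ℝ ∞ V)
    (hV : ∀ s, HasDerivAt V (q s) s) (hq : ∀ s, HasDerivAt q (q' s) s)
    (x : EuclideanSpace ℝ (Fin N)) :
    Δ (fun y : EuclideanSpace ℝ (Fin N) => V (‖y‖ ^ 2)) x =
      4 * ‖x‖ ^ 2 * q' (‖x‖ ^ 2) + 2 * N * q (‖x‖ ^ 2) := by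
  set f := fun y : EuclideanSpace ℝ (Fin N) => V (‖y‖ ^ 2) with hf
  have hfs : ContDiff ℝ ∞ f := hVs.comp (contDiff_norm_sq ℝ)
  have hd : Differentiable ℝ (fderiv ℝ f) :=
    (hfs.fderiv_right (m := 1) (by norm_cast)).differentiable (by norm_num)
  have key : ∀ e : EuclideanSpace ℝ (Fin N), iteratedFDeriv ℝ 2 f x ![e, e] =
      4 * q' (‖x‖ ^ 2) * inner ℝ e x ^ 2 + 2 * q (‖x‖ ^ 2) * ‖e‖ ^ 2 := by
    intro e
    rw [iteratedFDeriv_two_apply]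
    simp only [Matrix.cons_val_zero, Matrix.cons_val_one]
    have h1 : fderiv ℝ (fderiv ℝ f) x e e = fderiv ℝ (fun y => fderiv ℝ f y e) x e := by
      rw [fderiv_clm_apply (hd x) (differentiableAt_const e)]
      simp
    have h2 : (fun y => fderiv ℝ f y e) = fun y => (2 * q (‖y‖ ^ 2)) * inner ℝ e y := by
      ext y
      rw [(hasFDerivAt_comp_norm_sq (hV (‖y‖ ^ 2))).fderiv]
      simp [real_inner_comm]
    have h3 := ((hasFDerivAt_comp_norm_sq (hq (‖x‖ ^ 2))).const_mul 2).mul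
      ((innerSL ℝ e).hasFDerivAt (x := x))
    rw [h1, h2]
    have h4 : fderiv ℝ (fun y => (2 * q (‖y‖ ^ 2)) * inner ℝ e y) x = _ := h3.fderiv
    rw [h4]
    simp [real_inner_comm]
    ring
  rw [InnerProductSpace.laplacian_eq_iteratedFDeriv_stdOrthonormalBasis]
  simp only [key, Finset.sum_add_distrib, ← Finset.mul_sum]
  rw [OrthonormalBasis.sum_sq_inner_right]
  simp
  ring

theorem gradient_comp_norm {k : ℝ → ℝ} {z : EuclideanSpace ℝ (Fin N)} (hz : z ≠ 0)
    (hk : DifferentiableAt ℝ k ‖z‖) :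
    ∇ (radialKernel N k) z = (deriv k ‖z‖ / ‖z‖) • z := by
  have hz' : 0 < ‖z‖ := norm_pos_iff.2 hz
  have h2 : HasDerivAt (fun s => k (√s)) (deriv k ‖z‖ * (1 / (2 * ‖z‖))) (‖z‖ ^ 2) := by
    have h3 := Real.hasDerivAt_sqrt (x := ‖z‖ ^ 2) (by positivity)
    rw [Real.sqrt_sq hz'.le] at h3
    refine HasDerivAt.comp (‖z‖ ^ 2) ?_ h3
    rw [Real.sqrt_sq hz'.le]
    exact hk.hasDerivAt
  have h4 := gradient_comp_norm_sq h2
  have h5 : (fun y : EuclideanSpace ℝ (Fin N) => k (√(‖y‖ ^ 2))) = radialKernel N k := by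
    ext y
    rw [Real.sqrt_sq (norm_nonneg y), radialKernel]
  rw [h5] at h4
  rw [h4]
  congr 1
  field_simp

end RadialCalculus

/-! ### The interaction kernel and the pairwise virial. -/

section Kernel

variable {N : ℕ} {k : ℝ → ℝ}

/-- The gradient of the radial kernel away from the origin, extended by zero. -/
noncomputable def kernelGradient (N : ℕ) (k : ℝ → ℝ) (z : EuclideanSpace ℝ (Fin N)) :
    EuclideanSpace ℝ (Fin N) := (deriv k ‖z‖ / ‖z‖) • z

theorem kernelGradient_neg (z : EuclideanSpace ℝ (Fin N)) :
    kernelGradient N k (-z) = -kernelGradient N k z := by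
  simp [kernelGradient]

theorem kernelGradient_zero : kernelGradient N k 0 = 0 := by
  simp [kernelGradient]

theorem measurable_kernelGradient : Measurable (kernelGradient N k) := by
  unfold kernelGradient
  have := measurable_deriv k
  fun_prop

theorem IsMildlySingularProfile.abs_deriv_le (hk : IsMildlySingularProfile N k) {s : ℝ}
    (hs : 0 < s) : |deriv k s| ≤ supNormDeriv k :=
  le_csSup hk.bddAbove_deriv ⟨s, hs, rfl⟩

theorem IsMildlySingularProfile.deriv_le (hk : IsMildlySingularProfile N k) {Λ s : ℝ}
    (hs : 0 < s) (hsΛ : s < Λ) : deriv k s ≤ -kappa k Λ := by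
  rw [kappa, neg_neg]
  refine le_csSup ⟨supNormDeriv k, ?_⟩ ⟨s, ⟨hs, hsΛ⟩, rfl⟩
  rintro _ ⟨r, hr, rfl⟩
  exact (le_abs_self _).trans (hk.abs_deriv_le hr.1)

theorem IsMildlySingularProfile.kappa_le (hk : IsMildlySingularProfile N k) {Λ : ℝ}
    (hΛ : 0 < Λ) : kappa k Λ ≤ supNormDeriv k := by
  have h1 := hk.deriv_le (half_pos hΛ) (half_lt_self hΛ)
  have h2 := hk.abs_deriv_le (half_pos hΛ)
  have h3 := neg_abs_le (deriv k (Λ / 2))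
  linarith

theorem IsMildlySingularProfile.differentiableAt (hk : IsMildlySingularProfile N k) {s : ℝ}
    (hs : 0 < s) : DifferentiableAt ℝ k s :=
  (hk.contDiffOn.differentiableOn (by norm_num)).differentiableAt (Ioi_mem_nhds hs)

theorem IsMildlySingularProfile.supNormDeriv_pos (hk : IsMildlySingularProfile N k) :
    0 < supNormDeriv k := (hk.kappa_pos 1 one_pos).trans_le (hk.kappa_le one_pos)

theorem norm_kernelGradient_le (hk : IsMildlySingularProfile N k)
    (z : EuclideanSpace ℝ (Fin N)) : ‖kernelGradient N k z‖ ≤ supNormDeriv k := by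
  rcases eq_or_ne z 0 with rfl | hz
  · simpa [kernelGradient_zero] using hk.supNormDeriv_pos.le
  · have hz' : 0 < ‖z‖ := norm_pos_iff.2 hz
    rw [kernelGradient, norm_smul, norm_div, norm_norm, div_mul_cancel₀ _ hz'.ne']
    exact hk.abs_deriv_le hz'

/-- The two integrands differ at most at y = x, which is a null set because N ≥ 1. The new integrand
is bounded and odd everywhere, whatever `k` does at 0. -/
theorem drift_eq_integral_kernelGradient (hN : 1 ≤ N) (hk : IsMildlySingularProfile N k)
    (v : EuclideanSpace ℝ (Fin N) → ℝ) (x : EuclideanSpace ℝ (Fin N)) :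
    drift (radialKernel N k) v x = ∫ y, v y • kernelGradient N k (x - y) := by
  have : Nonempty (Fin N) := ⟨⟨0, hN⟩⟩
  refine integral_congr_ae ?_
  have h : ∀ᵐ y : EuclideanSpace ℝ (Fin N), y ≠ x := by
    simp [ae_iff]
  filter_upwards [h] with y hy
  have hxy : x - y ≠ 0 := sub_ne_zero.2 hy.symm
  rw [gradient_comp_norm hxy (hk.differentiableAt (norm_pos_iff.2 hxy)), kernelGradient]

/-- The weight `a (|x|²) x / |x|` of the truncated radial virial. -/
noncomputable def radialField (N : ℕ) (a : ℝ → ℝ) (x : EuclideanSpace ℝ (Fin N)) :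
    EuclideanSpace ℝ (Fin N) := (a (‖x‖ ^ 2) / ‖x‖) • x

theorem radialField_neg (a : ℝ → ℝ) (x : EuclideanSpace ℝ (Fin N)) :
    radialField N a (-x) = -radialField N a x := by
  simp [radialField]

theorem measurable_radialField {a : ℝ → ℝ} (ha : Measurable a) :
    Measurable (radialField N a) := by
  unfold radialField
  fun_prop

theorem norm_radialField_le {a : ℝ → ℝ} (h0 : ∀ s, 0 ≤ a s) (h1 : ∀ s, a s ≤ 1)
    (x : EuclideanSpace ℝ (Fin N)) : ‖radialField N a x‖ ≤ 1 := by
  rcases eq_or_ne x 0 with rfl | hx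
  · simp [radialField]
  · have hx' : 0 < ‖x‖ := norm_pos_iff.2 hx
    rw [radialField, norm_smul, norm_div, norm_norm, div_mul_cancel₀ _ hx'.ne',
      Real.norm_of_nonneg (h0 _)]
    exact h1 _

/-- The identity (x - y)·(x/|x| - y/|y|) = (|x| + |y|)(1 - cos θ) reduces the claim to |x - y| ≤ |x|
+ |y| and k' ≤ -κ_Λ on (0, Λ). -/
theorem inner_kernelGradient_sub_le (hk : IsMildlySingularProfile N k) {Λ : ℝ}
    {x y : EuclideanSpace ℝ (Fin N)} (hx : x ≠ 0) (hy : y ≠ 0) (hxΛ : ‖x‖ < Λ / 2)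
    (hyΛ : ‖y‖ < Λ / 2) :
    inner ℝ (kernelGradient N k (x - y)) (‖x‖⁻¹ • x - ‖y‖⁻¹ • y) ≤
      -kappa k Λ * (1 - inner ℝ x y / (‖x‖ * ‖y‖)) := by
  have hx' : 0 < ‖x‖ := norm_pos_iff.2 hx
  have hy' : 0 < ‖y‖ := norm_pos_iff.2 hy
  rcases eq_or_ne x y with rfl | hxy
  · rw [real_inner_self_eq_norm_mul_norm, div_self (by positivity)]
    simp
  have hz : 0 < ‖x - y‖ := norm_pos_iff.2 (sub_ne_zero.2 hxy)
  have htri : ‖x - y‖ ≤ ‖x‖ + ‖y‖ := norm_sub_le x y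
  have hd := hk.deriv_le hz (by linarith : ‖x - y‖ < Λ)
  have hκ : 0 < kappa k Λ := hk.kappa_pos Λ (by linarith)
  have hc : 0 ≤ 1 - inner ℝ x y / (‖x‖ * ‖y‖) := by
    rw [sub_nonneg, div_le_one (by positivity)]
    exact real_inner_le_norm x y
  have heq : inner ℝ (kernelGradient N k (x - y)) (‖x‖⁻¹ • x - ‖y‖⁻¹ • y) =
      deriv k ‖x - y‖ * ((‖x‖ + ‖y‖) / ‖x - y‖) * (1 - inner ℝ x y / (‖x‖ * ‖y‖)) := by
    rw [kernelGradient]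
    simp only [inner_smul_left, inner_sub_left, inner_sub_right, inner_smul_right,
      real_inner_self_eq_norm_sq, real_inner_comm x y]
    simp
    field_simp
    ring
  rw [heq]
  refine mul_le_mul_of_nonneg_right ?_ hc
  have h1 : 1 ≤ (‖x‖ + ‖y‖) / ‖x - y‖ := by rwa [one_le_div hz]
  nlinarith

end Kernel

/-! ### Symmetrisation of the virial. -/

section Virial

variable {N : ℕ} {k : ℝ → ℝ}

/-- On the annulus ρ ≤ r < Λ/2 the weight is the unit radial field, and adding the pair bounds for y
and -y cancels cos θ, leaving -2κ. Elsewhere the sum of four terms is at most 4L, and the right side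
is built to dominate that. -/
theorem symmetrized_virial_le (hk : IsMildlySingularProfile N k) {Λ ρ : ℝ} (hΛ : 0 < Λ)
    (hρ : 0 < ρ) {a : ℝ → ℝ} (h0 : ∀ s, 0 ≤ a s) (h1 : ∀ s, a s ≤ 1)
    (ha : ∀ r, ρ ≤ r → r < Λ / 2 → a (r ^ 2) = 1) (x y : EuclideanSpace ℝ (Fin N)) :
    inner ℝ (kernelGradient N k (x - y)) (radialField N a x) +
      inner ℝ (kernelGradient N k (y - x)) (radialField N a y) +
      inner ℝ (kernelGradient N k (x - -y)) (radialField N a x) +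
      inner ℝ (kernelGradient N k (-y - x)) (radialField N a (-y)) ≤
    (-2 * kappa k Λ - 4 * supNormDeriv k) *
        ((Metric.ball 0 (Λ / 2)).indicator (fun _ => (1 : ℝ)) x *
          (Metric.ball 0 (Λ / 2)).indicator (fun _ => (1 : ℝ)) y) +
      6 * supNormDeriv k * ((Metric.ball 0 ρ).indicator (fun _ => (1 : ℝ)) x +
          (Metric.ball 0 ρ).indicator (fun _ => (1 : ℝ)) y) + 4 * supNormDeriv k := by
  have hL := hk.supNormDeriv_pos
  have hκL := hk.kappa_le hΛ
  have hD : ∀ z w : EuclideanSpace ℝ (Fin N),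
      inner ℝ (kernelGradient N k z) (radialField N a w) ≤ supNormDeriv k := by
    intro z w
    have h2 := real_inner_le_norm (kernelGradient N k z) (radialField N a w)
    have h3 := norm_kernelGradient_le hk z
    have h4 := norm_radialField_le h0 h1 w
    calc _ ≤ _ := h2
      _ ≤ supNormDeriv k * 1 := mul_le_mul h3 h4 (norm_nonneg _) hL.le
      _ = _ := mul_one _
  have hcr : inner ℝ (kernelGradient N k (x - y)) (radialField N a x) +
      inner ℝ (kernelGradient N k (y - x)) (radialField N a y) +
      inner ℝ (kernelGradient N k (x - -y)) (radialField N a x) +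
      inner ℝ (kernelGradient N k (-y - x)) (radialField N a (-y)) ≤ 4 * supNormDeriv k := by
    linarith [hD (x - y) x, hD (y - x) y, hD (x - -y) x, hD (-y - x) (-y)]
  have hP : ∀ z : EuclideanSpace ℝ (Fin N),
      0 ≤ (Metric.ball 0 ρ).indicator (fun _ => (1 : ℝ)) z :=
    fun z => indicator_nonneg (fun _ _ => zero_le_one) z
  by_cases hx : x ∈ Metric.ball (0 : EuclideanSpace ℝ (Fin N)) (Λ / 2)
  swap
  · rw [indicator_of_notMem hx]
    have := mul_nonneg hL.le (add_nonneg (hP x) (hP y))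
    linarith
  by_cases hy : y ∈ Metric.ball (0 : EuclideanSpace ℝ (Fin N)) (Λ / 2)
  swap
  · rw [indicator_of_notMem hy]
    have := mul_nonneg hL.le (add_nonneg (hP x) (hP y))
    linarith
  rw [indicator_of_mem hx, indicator_of_mem hy]
  -- Source of the coefficient 6: since κ ≤ L, 6L ≥ 2κ + 4L, so one point in the small ball offsets
  -- the negative term.
  by_cases hx' : x ∈ Metric.ball (0 : EuclideanSpace ℝ (Fin N)) ρ
  · rw [indicator_of_mem hx']
    have := mul_nonneg hL.le (hP y)
    linarith
  by_cases hy' : y ∈ Metric.ball (0 : EuclideanSpace ℝ (Fin N)) ρ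
  · rw [indicator_of_mem hy']
    have := mul_nonneg hL.le (hP x)
    linarith
  rw [indicator_of_notMem hx', indicator_of_notMem hy']
  rw [mem_ball_zero_iff] at hx hy hx' hy'
  push Not at hx' hy'
  have hx0 : x ≠ 0 := norm_pos_iff.1 (hρ.trans_le hx')
  have hy0 : y ≠ 0 := norm_pos_iff.1 (hρ.trans_le hy')
  have hfx : radialField N a x = ‖x‖⁻¹ • x := by
    rw [radialField, ha _ hx' hx, one_div]
  have hfy : radialField N a y = ‖y‖⁻¹ • y := by
    rw [radialField, ha _ hy' hy, one_div]
  have e1 := inner_kernelGradient_sub_le hk hx0 hy0 hx hy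
  have e2 := inner_kernelGradient_sub_le hk hx0 (neg_ne_zero.2 hy0) hx (by rwa [norm_neg])
  rw [norm_neg, inner_neg_right, smul_neg] at e2
  rw [show y - x = -(x - y) by abel, show -y - x = -(x - -y) by abel, kernelGradient_neg,
    kernelGradient_neg, radialField_neg, hfx, hfy]
  simp only [inner_sub_right, inner_neg_right, inner_neg_left] at e1 e2 ⊢
  rw [neg_div] at e2
  linarith

theorem integrable_inner_kernelGradient (hk : IsMildlySingularProfile N k)
    (μ : Measure (EuclideanSpace ℝ (Fin N))) [IsFiniteMeasure μ] {a : ℝ → ℝ} (hm : Measurable a)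
    (h0 : ∀ s, 0 ≤ a s) (h1 : ∀ s, a s ≤ 1) :
    Integrable (fun p : EuclideanSpace ℝ (Fin N) × EuclideanSpace ℝ (Fin N) =>
      inner ℝ (kernelGradient N k (p.1 - p.2)) (radialField N a p.1)) (μ.prod μ) := by
  have h2 := measurable_kernelGradient (N := N) (k := k)
  have h3 := measurable_radialField (N := N) hm
  refine Integrable.of_bound (C := supNormDeriv k) ?_ (ae_of_all _ fun p => ?_)
  · refine Measurable.aestronglyMeasurable ?_
    exact (h2.comp (measurable_fst.sub measurable_snd)).inner (h3.comp measurable_fst)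
  · calc _ ≤ _ := norm_inner_le_norm _ _
      _ ≤ supNormDeriv k * 1 := mul_le_mul (norm_kernelGradient_le hk _)
          (norm_radialField_le h0 h1 _) (norm_nonneg _) hk.supNormDeriv_pos.le
      _ = _ := mul_one _

/-- The virial is a double integral over μ × μ, invariant under the swap and under (x, y) ↦ (x, -y).
It therefore equals a quarter of the integral of the four-term sum just bounded. -/
theorem virial_le (hk : IsMildlySingularProfile N k)
    (μ : Measure (EuclideanSpace ℝ (Fin N))) [IsFiniteMeasure μ] [μ.IsNegInvariant]
    {Λ ρ : ℝ} (hΛ : 0 < Λ)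
    (hρ : 0 < ρ) {a : ℝ → ℝ} (hm : Measurable a) (h0 : ∀ s, 0 ≤ a s) (h1 : ∀ s, a s ≤ 1)
    (ha : ∀ r, ρ ≤ r → r < Λ / 2 → a (r ^ 2) = 1) :
    ∫ x, inner ℝ (∫ y, kernelGradient N k (x - y) ∂μ) (radialField N a x) ∂μ ≤
      -(kappa k Λ / 2 + supNormDeriv k) * μ.real (Metric.ball 0 (Λ / 2)) ^ 2 +
      3 * supNormDeriv k * μ.real univ * μ.real (Metric.ball 0 ρ) +
      supNormDeriv k * μ.real univ ^ 2 := by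
  set D : EuclideanSpace ℝ (Fin N) × EuclideanSpace ℝ (Fin N) → ℝ := fun p =>
    inner ℝ (kernelGradient N k (p.1 - p.2)) (radialField N a p.1) with hD
  have hDi : Integrable D (μ.prod μ) := integrable_inner_kernelGradient hk μ hm h0 h1
  have hJ : ∫ x, inner ℝ (∫ y, kernelGradient N k (x - y) ∂μ) (radialField N a x) ∂μ =
      ∫ p, D p ∂(μ.prod μ) := by
    rw [integral_prod _ hDi]
    refine integral_congr_ae (ae_of_all _ fun x => ?_)
    have hgi : Integrable (fun y => kernelGradient N k (x - y)) μ := by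
      refine Integrable.of_bound (C := supNormDeriv k) ?_
        (ae_of_all _ fun y => norm_kernelGradient_le hk _)
      exact (measurable_kernelGradient.comp (measurable_const.sub
        measurable_id)).aestronglyMeasurable
    simp only [hD]
    rw [real_inner_comm, ← integral_inner hgi]
    simp only [real_inner_comm]
  have hneg : MeasurePreserving (fun p : EuclideanSpace ℝ (Fin N) × EuclideanSpace ℝ (Fin N) =>
      (p.1, -p.2)) (μ.prod μ) (μ.prod μ) :=
    (MeasurePreserving.id μ).prod (Measure.measurePreserving_neg μ)
  have hswap : MeasurePreserving Prod.swap (μ.prod μ) (μ.prod μ) :=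
    Measure.measurePreserving_swap
  have hnegswap := hswap.comp hneg
  have hint : ∀ {T : EuclideanSpace ℝ (Fin N) × EuclideanSpace ℝ (Fin N) →
      EuclideanSpace ℝ (Fin N) × EuclideanSpace ℝ (Fin N)},
      MeasurePreserving T (μ.prod μ) (μ.prod μ) →
      Integrable (fun p => D (T p)) (μ.prod μ) ∧
        ∫ p, D (T p) ∂(μ.prod μ) = ∫ p, D p ∂(μ.prod μ) := by
    intro T hT
    refine ⟨hT.integrable_comp_of_integrable hDi, ?_⟩
    have h := integral_map (μ := μ.prod μ) hT.measurable.aemeasurable (f := D)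
      (by rw [hT.map_eq]; exact hDi.aestronglyMeasurable)
    rw [hT.map_eq] at h
    exact h.symm
  obtain ⟨i1, j1⟩ := hint hswap
  obtain ⟨i2, j2⟩ := hint hneg
  obtain ⟨i3, j3⟩ := hint hnegswap
  have hsum : 4 * ∫ p, D p ∂(μ.prod μ) = ∫ p, (D p + D p.swap + D (p.1, -p.2) +
      D (-p.2, p.1)) ∂(μ.prod μ) := by
    have e3 : ∫ p, D (-p.2, p.1) ∂(μ.prod μ) = ∫ p, D p ∂(μ.prod μ) := j3
    have i3' : Integrable (fun p => D (-p.2, p.1)) (μ.prod μ) := i3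
    have i01 : Integrable (fun p => D p + D p.swap) (μ.prod μ) := hDi.add i1
    have i012 : Integrable (fun p => D p + D p.swap + D (p.1, -p.2)) (μ.prod μ) := i01.add i2
    rw [integral_add i012 i3', integral_add i01 i2, integral_add hDi i1, j1, j2, e3]
    ring
  set I : EuclideanSpace ℝ (Fin N) → ℝ :=
    (Metric.ball 0 (Λ / 2)).indicator (fun _ => (1 : ℝ)) with hI
  set P : EuclideanSpace ℝ (Fin N) → ℝ :=
    (Metric.ball 0 ρ).indicator (fun _ => (1 : ℝ)) with hP
  have hIi : Integrable I μ := (integrable_const 1).indicator Metric.isOpen_ball.measurableSet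
  have hPi : Integrable P μ := (integrable_const 1).indicator Metric.isOpen_ball.measurableSet
  have hII : ∫ p, I p.1 * I p.2 ∂(μ.prod μ) = μ.real (Metric.ball 0 (Λ / 2)) ^ 2 := by
    rw [integral_prod_mul, hI, integral_indicator_const _ Metric.isOpen_ball.measurableSet]
    simp [sq]
  have hP1 : ∫ p, P p.1 ∂(μ.prod μ) = μ.real univ * μ.real (Metric.ball 0 ρ) := by
    rw [integral_fun_fst, hP, integral_indicator_const _ Metric.isOpen_ball.measurableSet]
    simp
  have hP2 : ∫ p, P p.2 ∂(μ.prod μ) = μ.real univ * μ.real (Metric.ball 0 ρ) := by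
    rw [integral_fun_snd, hP, integral_indicator_const _ Metric.isOpen_ball.measurableSet]
    simp
  have hA : Integrable (fun p : EuclideanSpace ℝ (Fin N) × EuclideanSpace ℝ (Fin N) =>
      (-2 * kappa k Λ - 4 * supNormDeriv k) * (I p.1 * I p.2)) (μ.prod μ) :=
    (hIi.mul_prod hIi).const_mul _
  have hB0 : Integrable (fun p : EuclideanSpace ℝ (Fin N) × EuclideanSpace ℝ (Fin N) =>
      P p.1 + P p.2) (μ.prod μ) := (hPi.comp_fst μ).add (hPi.comp_snd μ)
  have hB : Integrable (fun p : EuclideanSpace ℝ (Fin N) × EuclideanSpace ℝ (Fin N) =>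
      6 * supNormDeriv k * (P p.1 + P p.2)) (μ.prod μ) := hB0.const_mul _
  have hAB : Integrable (fun p : EuclideanSpace ℝ (Fin N) × EuclideanSpace ℝ (Fin N) =>
      (-2 * kappa k Λ - 4 * supNormDeriv k) * (I p.1 * I p.2) +
        6 * supNormDeriv k * (P p.1 + P p.2)) (μ.prod μ) := hA.add hB
  have hle : ∫ p, (D p + D p.swap + D (p.1, -p.2) + D (-p.2, p.1)) ∂(μ.prod μ) ≤
      ∫ p, ((-2 * kappa k Λ - 4 * supNormDeriv k) * (I p.1 * I p.2) +
        6 * supNormDeriv k * (P p.1 + P p.2) + 4 * supNormDeriv k) ∂(μ.prod μ) :=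
    integral_mono (((hDi.add i1).add i2).add i3) (hAB.add (integrable_const _)) fun p =>
      symmetrized_virial_le hk hΛ hρ h0 h1 ha p.1 p.2
  rw [integral_add hAB (integrable_const _), integral_add hA hB, integral_const_mul,
    integral_const_mul, integral_add (hPi.comp_fst μ) (hPi.comp_snd μ), hII, hP1, hP2,
    integral_const] at hle
  have huniv : (μ.prod μ).real univ = μ.real univ ^ 2 := by
    rw [← univ_prod_univ, measureReal_prod_prod, sq]
  rw [huniv, smul_eq_mul, ← hsum] at hle
  rw [hJ]
  linarith

end Virial

/-! ### Nonnegative densities as measures. -/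

section Density

variable {N : ℕ}

/-- The measure with the nonnegative density `v`. -/
noncomputable def densityMeasure (v : EuclideanSpace ℝ (Fin N) → ℝ) :
    Measure (EuclideanSpace ℝ (Fin N)) := volume.withDensity fun x => ENNReal.ofReal (v x)

variable {v : EuclideanSpace ℝ (Fin N) → ℝ}

theorem isFiniteMeasure_densityMeasure (hv : Integrable v) : IsFiniteMeasure (densityMeasure v) :=
  isFiniteMeasure_withDensity_ofReal hv.2

theorem integral_densityMeasure {F : Type*} [NormedAddCommGroup F] [NormedSpace ℝ F]
    (hv : Integrable v) (h0 : 0 ≤ᵐ[volume] v) (g : EuclideanSpace ℝ (Fin N) → F) :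
    ∫ x, g x ∂(densityMeasure v) = ∫ x, v x • g x := by
  rw [densityMeasure, integral_withDensity_eq_integral_toReal_smul₀
    hv.aestronglyMeasurable.aemeasurable.ennreal_ofReal (ae_of_all _ fun _ => ENNReal.ofReal_lt_top)]
  refine integral_congr_ae ?_
  filter_upwards [h0] with x hx
  rw [ENNReal.toReal_ofReal hx]

theorem densityMeasure_real (hv : Integrable v) (h0 : 0 ≤ᵐ[volume] v)
    {s : Set (EuclideanSpace ℝ (Fin N))} (hs : MeasurableSet s) :
    (densityMeasure v).real s = ∫ x in s, v x := by
  rw [measureReal_def, densityMeasure, withDensity_apply _ hs, integral_eq_lintegral_of_nonneg_ae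
    (ae_restrict_of_ae h0) hv.aestronglyMeasurable.restrict]

/-- Radial symmetry is applied to the single isometry x ↦ -x. -/
theorem isNegInvariant_densityMeasure (hv : Integrable v) (hr : IsRadial v) :
    (densityMeasure v).IsNegInvariant := by
  constructor
  have hm := hv.aestronglyMeasurable.aemeasurable
  ext s hs
  rw [Measure.neg, Measure.map_apply measurable_neg hs, densityMeasure, withDensity_apply _ hs,
    withDensity_apply _ (measurable_neg hs)]
  have h1 := (Measure.measurePreserving_neg
    (volume : Measure (EuclideanSpace ℝ (Fin N)))).setLIntegral_comp_preimage_emb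
    (MeasurableEquiv.neg _).measurableEmbedding (fun x => ENNReal.ofReal (v x)) s
  rw [← h1]
  refine lintegral_congr_ae (ae_restrict_of_ae ?_)
  filter_upwards [hr (LinearIsometryEquiv.neg ℝ)] with x hx
  simp only [LinearIsometryEquiv.coe_neg] at hx
  rw [← hx]

end Density

/-! ### The annular cutoff and the truncated radius. -/

section Cutoff

theorem deriv_smoothTransition_of_nonpos {z : ℝ} (hz : z ≤ 0) :
    deriv Real.smoothTransition z = 0 := by
  apply IsLocalMin.deriv_eq_zero
  refine Eventually.of_forall fun y => ?_
  rw [Real.smoothTransition.zero_of_nonpos hz]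
  exact Real.smoothTransition.nonneg y

theorem deriv_smoothTransition_of_one_le {z : ℝ} (hz : 1 ≤ z) :
    deriv Real.smoothTransition z = 0 := by
  apply IsLocalMax.deriv_eq_zero
  refine Eventually.of_forall fun y => ?_
  rw [Real.smoothTransition.one_of_one_le hz]
  exact Real.smoothTransition.le_one y

theorem contDiff_deriv_smoothTransition : ContDiff ℝ ∞ (deriv Real.smoothTransition) :=
  (contDiff_infty_iff_deriv.1 Real.smoothTransition.contDiff).2

theorem exists_bound_deriv_smoothTransition : ∃ S : ℝ, 0 < S ∧
    (∀ z, |deriv Real.smoothTransition z| ≤ S) ∧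
    ∀ z, |deriv (deriv Real.smoothTransition) z| ≤ S := by
  have hc : HasCompactSupport (deriv Real.smoothTransition) := by
    refine HasCompactSupport.intro (isCompact_Icc (a := (0 : ℝ)) (b := 1)) fun z hz => ?_
    rw [mem_Icc, not_and_or, not_le, not_le] at hz
    rcases hz with hz | hz
    · exact deriv_smoothTransition_of_nonpos hz.le
    · exact deriv_smoothTransition_of_one_le hz.le
  obtain ⟨C, hC⟩ := hc.exists_bound_of_continuous contDiff_deriv_smoothTransition.continuous
  obtain ⟨D, hD⟩ := hc.deriv.exists_bound_of_continuous
    (contDiff_infty_iff_deriv.1 contDiff_deriv_smoothTransition).2.continuous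
  have hC0 : 0 ≤ C := (norm_nonneg _).trans (hC 0)
  have hD0 : 0 ≤ D := (norm_nonneg _).trans (hD 0)
  refine ⟨C + D + 1, by linarith, fun z => ?_, fun z => ?_⟩
  · have := hC z
    rw [Real.norm_eq_abs] at this
    linarith
  · have := hD z
    rw [Real.norm_eq_abs] at this
    linarith

/-- A smooth cutoff in `s = |x|²`, equal to `1` for `2 ε² ≤ s ≤ Λ² / 4` and vanishing for `s ≤ ε²`
and for `s ≥ Λ²`. -/
noncomputable def annularCutoff (ε Λ s : ℝ) : ℝ :=
  Real.smoothTransition (s / ε ^ 2 - 1) *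
    Real.smoothTransition ((Λ ^ 2 - s) * (4 / (3 * Λ ^ 2)))

variable {ε Λ s : ℝ}

theorem annularCutoff_nonneg : 0 ≤ annularCutoff ε Λ s :=
  mul_nonneg (Real.smoothTransition.nonneg _) (Real.smoothTransition.nonneg _)

theorem annularCutoff_le_one : annularCutoff ε Λ s ≤ 1 :=
  mul_le_one₀ (Real.smoothTransition.le_one _) (Real.smoothTransition.nonneg _)
    (Real.smoothTransition.le_one _)

theorem annularCutoff_of_le (hε : 0 < ε) (hs : s ≤ ε ^ 2) : annularCutoff ε Λ s = 0 := by
  rw [annularCutoff, Real.smoothTransition.zero_of_nonpos, zero_mul]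
  rw [sub_nonpos, div_le_one (by positivity)]
  exact hs

theorem annularCutoff_of_ge (hs : Λ ^ 2 ≤ s) : annularCutoff ε Λ s = 0 := by
  rw [annularCutoff, Real.smoothTransition.zero_of_nonpos (x := (Λ ^ 2 - s) * _), mul_zero]
  exact mul_nonpos_of_nonpos_of_nonneg (by linarith) (by positivity)

theorem annularCutoff_eq_one (hε : 0 < ε) (hΛ : 0 < Λ) (h1 : 2 * ε ^ 2 ≤ s)
    (h2 : s ≤ Λ ^ 2 / 4) : annularCutoff ε Λ s = 1 := by
  rw [annularCutoff, Real.smoothTransition.one_of_one_le, Real.smoothTransition.one_of_one_le,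
    mul_one]
  · rw [mul_div_assoc', le_div_iff₀ (by positivity)]
    linarith
  · rw [le_sub_iff_add_le, le_div_iff₀ (by positivity)]
    linarith

theorem contDiff_annularCutoff (ε Λ : ℝ) : ContDiff ℝ ∞ (annularCutoff ε Λ) := by
  unfold annularCutoff
  refine ContDiff.mul ?_ ?_
  · exact Real.smoothTransition.contDiff.comp (by fun_prop)
  · exact Real.smoothTransition.contDiff.comp (by fun_prop)

theorem hasDerivAt_annularCutoff (ε Λ s : ℝ) : HasDerivAt (annularCutoff ε Λ)
    (deriv Real.smoothTransition (s / ε ^ 2 - 1) * (1 / ε ^ 2) *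
      Real.smoothTransition ((Λ ^ 2 - s) * (4 / (3 * Λ ^ 2))) +
      Real.smoothTransition (s / ε ^ 2 - 1) *
        (deriv Real.smoothTransition ((Λ ^ 2 - s) * (4 / (3 * Λ ^ 2))) *
          (-1 * (4 / (3 * Λ ^ 2))))) s := by
  have hσ : ∀ z, HasDerivAt Real.smoothTransition (deriv Real.smoothTransition z) z := fun z =>
    ((Real.smoothTransition.contDiff (n := 1)).differentiable (by norm_num) z).hasDerivAt
  refine HasDerivAt.mul ?_ ?_
  · exact (hσ _).comp s (((hasDerivAt_id s).div_const _).sub_const _)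
  · exact (hσ _).comp s (((hasDerivAt_id s).const_sub _).mul_const _)

/-- The inner edge has slope of order ε⁻² in s = r² and is active only for r < 2ε, so it contributes
O(1) there. The outer edge has slope of order Λ⁻² and acts only for r < Λ, hence O(ε/Λ). -/
theorem mul_deriv_annularCutoff_le {S : ℝ} (hS : ∀ z, |deriv Real.smoothTransition z| ≤ S)
    (hε : 0 < ε) (hΛ : 0 < Λ) {r : ℝ} (hr : 0 < r) :
    ε * (2 * r * deriv (annularCutoff ε Λ) (r ^ 2)) ≤
      (if r < 2 * ε then 4 * S else 0) + 3 * S * ε / Λ := by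
  have hS0 : 0 ≤ S := (abs_nonneg _).trans (hS 0)
  rw [(hasDerivAt_annularCutoff ε Λ (r ^ 2)).deriv]
  set σ := Real.smoothTransition
  have h1 : ε * (2 * r * (deriv σ (r ^ 2 / ε ^ 2 - 1) * (1 / ε ^ 2) *
      σ ((Λ ^ 2 - r ^ 2) * (4 / (3 * Λ ^ 2))))) ≤ if r < 2 * ε then 4 * S else 0 := by
    split_ifs with h
    · have ha : deriv σ (r ^ 2 / ε ^ 2 - 1) * σ ((Λ ^ 2 - r ^ 2) * (4 / (3 * Λ ^ 2))) ≤ S := by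
        calc _ ≤ S * σ ((Λ ^ 2 - r ^ 2) * (4 / (3 * Λ ^ 2))) :=
              mul_le_mul_of_nonneg_right ((le_abs_self _).trans (hS _))
                (Real.smoothTransition.nonneg _)
          _ ≤ S * 1 := mul_le_mul_of_nonneg_left (Real.smoothTransition.le_one _) hS0
          _ = S := mul_one S
      calc _ = 2 * (r / ε) *
            (deriv σ (r ^ 2 / ε ^ 2 - 1) * σ ((Λ ^ 2 - r ^ 2) * (4 / (3 * Λ ^ 2)))) := by
            field_simp
        _ ≤ 2 * (r / ε) * S := mul_le_mul_of_nonneg_left ha (by positivity)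
        _ ≤ 2 * 2 * S := by
            have : r / ε ≤ 2 := by rw [div_le_iff₀ hε]; exact h.le
            gcongr
        _ = 4 * S := by ring
    · have : deriv σ (r ^ 2 / ε ^ 2 - 1) = 0 := by
        apply deriv_smoothTransition_of_one_le
        rw [le_sub_iff_add_le, le_div_iff₀ (by positivity)]
        nlinarith
      simp [this]
  have h2 : ε * (2 * r * (σ (r ^ 2 / ε ^ 2 - 1) *
      (deriv σ ((Λ ^ 2 - r ^ 2) * (4 / (3 * Λ ^ 2))) * (-1 * (4 / (3 * Λ ^ 2)))))) ≤
      3 * S * ε / Λ := by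
    rcases le_or_gt Λ r with h | h
    · have : deriv σ ((Λ ^ 2 - r ^ 2) * (4 / (3 * Λ ^ 2))) = 0 := by
        apply deriv_smoothTransition_of_nonpos
        exact mul_nonpos_of_nonpos_of_nonneg (by nlinarith) (by positivity)
      rw [this]
      simp
      positivity
    · set D := deriv σ ((Λ ^ 2 - r ^ 2) * (4 / (3 * Λ ^ 2)))
      have ha : σ (r ^ 2 / ε ^ 2 - 1) * -D ≤ S := by
        calc _ ≤ σ (r ^ 2 / ε ^ 2 - 1) * S :=
              mul_le_mul_of_nonneg_left ((neg_le_abs _).trans (hS _))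
                (Real.smoothTransition.nonneg _)
          _ ≤ 1 * S := mul_le_mul_of_nonneg_right (Real.smoothTransition.le_one _) hS0
          _ = S := one_mul S
      calc _ = ε / Λ * (r / Λ) * (8 / 3) * (σ (r ^ 2 / ε ^ 2 - 1) * -D) := by
            field_simp
            ring
        _ ≤ ε / Λ * (r / Λ) * (8 / 3) * S := mul_le_mul_of_nonneg_left ha (by positivity)
        _ ≤ ε / Λ * 1 * 3 * S := by
            have : r / Λ ≤ 1 := by rw [div_le_iff₀ hΛ]; linarith
            gcongr
            norm_num
        _ = _ := by ring
  calc _ = _ := by rw [mul_add, mul_add]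
    _ ≤ _ := add_le_add h1 h2

/-- The radial profile of the truncated moment: a smooth version of `min r Λ`. -/
noncomputable def truncatedRadius (ε Λ r : ℝ) : ℝ := ∫ ρ in (0 : ℝ)..r, annularCutoff ε Λ (ρ ^ 2)

theorem continuous_annularCutoff_sq (ε Λ : ℝ) : Continuous fun ρ => annularCutoff ε Λ (ρ ^ 2) :=
  (contDiff_annularCutoff ε Λ).continuous.comp (continuous_pow 2)

theorem hasDerivAt_truncatedRadius (ε Λ r : ℝ) :
    HasDerivAt (truncatedRadius ε Λ) (annularCutoff ε Λ (r ^ 2)) r :=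
  (continuous_annularCutoff_sq ε Λ).integral_hasStrictDerivAt 0 r |>.hasDerivAt

theorem monotone_truncatedRadius : Monotone (truncatedRadius ε Λ) := by
  refine monotone_of_deriv_nonneg (fun r => (hasDerivAt_truncatedRadius ε Λ r).differentiableAt)
    fun r => ?_
  rw [(hasDerivAt_truncatedRadius ε Λ r).deriv]
  exact annularCutoff_nonneg

theorem truncatedRadius_zero : truncatedRadius ε Λ 0 = 0 := by simp [truncatedRadius]

theorem truncatedRadius_nonneg {r : ℝ} (hr : 0 ≤ r) : 0 ≤ truncatedRadius ε Λ r :=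
  truncatedRadius_zero.symm.le.trans (monotone_truncatedRadius hr)

theorem truncatedRadius_of_le (hε : 0 < ε) {r : ℝ} (h0 : 0 ≤ r) (hr : r ≤ ε) :
    truncatedRadius ε Λ r = 0 := by
  rw [truncatedRadius]
  refine intervalIntegral.integral_zero_ae (ae_of_all _ fun ρ hρ => ?_)
  rw [uIoc_of_le h0] at hρ
  refine annularCutoff_of_le hε ?_
  nlinarith [hρ.1, hρ.2]

theorem truncatedRadius_of_ge (hΛ : 0 < Λ) {r : ℝ} (hr : Λ ≤ r) :
    truncatedRadius ε Λ r = truncatedRadius ε Λ Λ := by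
  have hi : ∀ a b, IntervalIntegrable (fun ρ => annularCutoff ε Λ (ρ ^ 2)) volume a b :=
    fun a b => (continuous_annularCutoff_sq ε Λ).intervalIntegrable a b
  rw [← sub_eq_zero, truncatedRadius, truncatedRadius,
    intervalIntegral.integral_interval_sub_left (hi _ _) (hi _ _)]
  refine intervalIntegral.integral_zero_ae (ae_of_all _ fun ρ hρ => ?_)
  rw [uIoc_of_le hr] at hρ
  refine annularCutoff_of_ge ?_
  nlinarith [hρ.1, hρ.2]

theorem truncatedRadius_le_self {r : ℝ} (hr : 0 ≤ r) : truncatedRadius ε Λ r ≤ r := by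
  have h := intervalIntegral.integral_mono_on (μ := volume) hr
    ((continuous_annularCutoff_sq ε Λ).intervalIntegrable 0 r)
    (intervalIntegrable_const (c := (1 : ℝ))) fun _ _ => annularCutoff_le_one
  simpa [truncatedRadius] using h

theorem truncatedRadius_le_min (hΛ : 0 < Λ) {r : ℝ} (hr : 0 ≤ r) :
    truncatedRadius ε Λ r ≤ min r Λ := by
  refine le_min (truncatedRadius_le_self hr) ?_
  rcases le_total r Λ with h | h
  · exact (truncatedRadius_le_self hr).trans h
  · rw [truncatedRadius_of_ge hΛ h]
    exact truncatedRadius_le_self hΛ.le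

theorem le_truncatedRadius (hε : 0 < ε) (hΛ : 0 < Λ) {r : ℝ} (hr : Λ / 2 ≤ r) :
    Λ / 2 - 2 * ε ≤ truncatedRadius ε Λ r := by
  rcases le_or_gt (Λ / 2) (2 * ε) with h | h
  · have := truncatedRadius_nonneg (ε := ε) (Λ := Λ) (by linarith : 0 ≤ r)
    linarith
  have hi : ∀ a b, IntervalIntegrable (fun ρ => annularCutoff ε Λ (ρ ^ 2)) volume a b :=
    fun a b => (continuous_annularCutoff_sq ε Λ).intervalIntegrable a b
  have h1 : truncatedRadius ε Λ (Λ / 2) - truncatedRadius ε Λ (2 * ε) = Λ / 2 - 2 * ε := by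
    rw [truncatedRadius, truncatedRadius,
      intervalIntegral.integral_interval_sub_left (hi _ _) (hi _ _)]
    rw [intervalIntegral.integral_congr (g := fun _ => (1 : ℝ))]
    · simp
    · intro ρ hρ
      rw [uIcc_of_le h.le] at hρ
      exact annularCutoff_eq_one hε hΛ (by nlinarith [hρ.1]) (by nlinarith [hρ.1, hρ.2])
  have h2 := truncatedRadius_nonneg (ε := ε) (Λ := Λ) (by linarith : 0 ≤ 2 * ε)
  have h3 := monotone_truncatedRadius (ε := ε) (Λ := Λ) hr
  linarith

/-- The cutoff vanishes for s ≤ ε², which removes the singularity of the square root at 0 and covers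
negative s. -/
theorem contDiff_annularCutoff_div_sqrt (hε : 0 < ε) :
    ContDiff ℝ ∞ fun s => annularCutoff ε Λ s / (2 * √s) := by
  rw [contDiff_iff_contDiffAt]
  intro s
  rcases lt_or_ge s (ε ^ 2) with hs | hs
  · refine (contDiffAt_const (c := (0 : ℝ))).congr_of_eventuallyEq ?_
    filter_upwards [Iio_mem_nhds hs] with t ht
    rw [annularCutoff_of_le hε (le_of_lt ht), zero_div]
  · have hs0 : 0 < s := lt_of_lt_of_le (by positivity) hs
    exact (contDiff_annularCutoff ε Λ).contDiffAt.div
      (contDiffAt_const.mul (Real.contDiffAt_sqrt hs0.ne')) (by positivity)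

theorem hasDerivAt_truncatedRadius_sqrt (hε : 0 < ε) (s : ℝ) :
    HasDerivAt (fun s => truncatedRadius ε Λ (√s)) (annularCutoff ε Λ s / (2 * √s)) s := by
  rcases lt_or_ge s (ε ^ 2) with hs | hs
  · rw [annularCutoff_of_le hε hs.le, zero_div]
    refine (hasDerivAt_const s (0 : ℝ)).congr_of_eventuallyEq ?_
    filter_upwards [Iio_mem_nhds hs] with t ht
    exact truncatedRadius_of_le hε (Real.sqrt_nonneg t)
      ((Real.sqrt_le_sqrt (le_of_lt ht)).trans (Real.sqrt_sq hε.le).le)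
  · have hs0 : 0 < s := lt_of_lt_of_le (by positivity) hs
    have h := (hasDerivAt_truncatedRadius ε Λ (√s)).comp s (Real.hasDerivAt_sqrt hs0.ne')
    rw [Real.sq_sqrt hs0.le] at h
    refine h.congr_deriv ?_
    ring

theorem contDiff_truncatedRadius_sqrt (hε : 0 < ε) :
    ContDiff ℝ ∞ fun s => truncatedRadius ε Λ (√s) := by
  rw [contDiff_infty_iff_deriv]
  refine ⟨fun s => (hasDerivAt_truncatedRadius_sqrt hε s).differentiableAt, ?_⟩
  rw [show deriv (fun s => truncatedRadius ε Λ (√s)) = fun s => annularCutoff ε Λ s / (2 * √s) from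
    funext fun s => (hasDerivAt_truncatedRadius_sqrt hε s).deriv]
  exact contDiff_annularCutoff_div_sqrt hε

end Cutoff

/-! ### Test functions for the moment and for the mass. -/

section TestFunction

variable {N : ℕ} {ε Λ : ℝ}

/-- The test function whose integral measures the deficit of the truncated first moment. -/
noncomputable def momentTest (N : ℕ) (ε Λ : ℝ) (x : EuclideanSpace ℝ (Fin N)) : ℝ :=
  truncatedRadius ε Λ Λ - truncatedRadius ε Λ (√(‖x‖ ^ 2))

theorem contDiff_momentTest (hε : 0 < ε) : ContDiff ℝ ∞ (momentTest N ε Λ) :=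
  contDiff_const.sub ((contDiff_truncatedRadius_sqrt hε).comp (contDiff_norm_sq ℝ))

theorem hasCompactSupport_momentTest (hΛ : 0 < Λ) : HasCompactSupport (momentTest N ε Λ) := by
  refine HasCompactSupport.intro (isCompact_closedBall 0 Λ) fun x hx => ?_
  rw [mem_closedBall_zero_iff, not_le] at hx
  rw [momentTest, Real.sqrt_sq (norm_nonneg x), truncatedRadius_of_ge hΛ hx.le, sub_self]

theorem gradient_momentTest (hε : 0 < ε) (x : EuclideanSpace ℝ (Fin N)) :
    ∇ (momentTest N ε Λ) x = -radialField N (annularCutoff ε Λ) x := by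
  have h := gradient_comp_norm_sq (x := x)
    ((hasDerivAt_truncatedRadius_sqrt (Λ := Λ) hε (‖x‖ ^ 2)).const_sub (truncatedRadius ε Λ Λ))
  refine h.trans ?_
  rw [radialField, ← neg_smul, Real.sqrt_sq (norm_nonneg x)]
  congr 1
  rcases eq_or_ne ‖x‖ 0 with h0 | h0
  · simp [h0]
  · field_simp

/-- In polar form the left side is ε(2r a'(r²) + (N - 1)a(r²)/r). The curvature part is at most N -
1 everywhere because a = 0 for r ≤ ε, and at most (N - 1)/λ once r ≥ λε. -/
theorem neg_laplacian_momentTest_le {S : ℝ} (hS : ∀ z, |deriv Real.smoothTransition z| ≤ S)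
    (hN : 1 ≤ N) (hε : 0 < ε) (hΛ : 0 < Λ) {lam : ℝ} (hlam : 2 ≤ lam)
    (x : EuclideanSpace ℝ (Fin N)) :
    -(ε * Δ (momentTest N ε Λ) x) ≤
      (4 * S + N) * (Metric.ball 0 (lam * ε)).indicator (fun _ => (1 : ℝ)) x +
        (3 * S * ε / Λ + N / lam) := by
  have hS0 : 0 ≤ S := (abs_nonneg _).trans (hS 0)
  have hN' : (1 : ℝ) ≤ N := by exact_mod_cast hN
  have hq := contDiff_annularCutoff_div_sqrt (Λ := Λ) hε
  have hqd : ∀ s, HasDerivAt (fun s => -(annularCutoff ε Λ s / (2 * √s)))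
      (-deriv (fun s => annularCutoff ε Λ s / (2 * √s)) s) s := fun s =>
    ((hq.differentiable (by norm_num)) s).hasDerivAt.neg
  have hlap := laplacian_comp_norm_sq
    (contDiff_const.sub (contDiff_truncatedRadius_sqrt (Λ := Λ) hε))
    (fun s => (hasDerivAt_truncatedRadius_sqrt (Λ := Λ) hε s).const_sub (truncatedRadius ε Λ Λ))
    hqd x
  have hlap' : Δ (momentTest N ε Λ) x = _ := hlap
  rw [hlap']
  have hrhs : 0 ≤ (4 * S + N) * (Metric.ball 0 (lam * ε)).indicator (fun _ => (1 : ℝ)) x +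
        (3 * S * ε / Λ + N / lam) := by
    have := indicator_nonneg (s := Metric.ball (0 : EuclideanSpace ℝ (Fin N)) (lam * ε))
      (f := fun _ => (1 : ℝ)) (fun _ _ => zero_le_one) x
    positivity
  rcases eq_or_ne ‖x‖ 0 with h0 | h0
  · simpa [h0] using hrhs
  have hr : 0 < ‖x‖ := lt_of_le_of_ne (norm_nonneg x) h0.symm
  set r := ‖x‖ with hrdef
  have hsqrt := Real.hasDerivAt_sqrt (x := r ^ 2) (by positivity)
  have hda : HasDerivAt (annularCutoff ε Λ) (deriv (annularCutoff ε Λ) (r ^ 2)) (r ^ 2) :=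
    ((contDiff_annularCutoff ε Λ).differentiable (by norm_num) _).hasDerivAt
  have hqr := (hda.div (hsqrt.const_mul 2) (by positivity)).deriv
  rw [show deriv (fun s => annularCutoff ε Λ s / (2 * √s)) (r ^ 2) = _ from hqr,
    Real.sqrt_sq hr.le]
  have heq : -(ε * (4 * r ^ 2 * -((deriv (annularCutoff ε Λ) (r ^ 2) * (2 * r) -
      annularCutoff ε Λ (r ^ 2) * (2 * (1 / (2 * r)))) / (2 * r) ^ 2) +
      2 * N * -(annularCutoff ε Λ (r ^ 2) / (2 * r)))) =
      ε * (2 * r * deriv (annularCutoff ε Λ) (r ^ 2)) +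
        (N - 1) * (annularCutoff ε Λ (r ^ 2) * (ε / r)) := by
    field_simp
    ring
  rw [heq]
  have h1 := mul_deriv_annularCutoff_le hS hε hΛ hr
  have ha0 := annularCutoff_nonneg (ε := ε) (Λ := Λ) (s := r ^ 2)
  have ha1 := annularCutoff_le_one (ε := ε) (Λ := Λ) (s := r ^ 2)
  by_cases hx : x ∈ Metric.ball (0 : EuclideanSpace ℝ (Fin N)) (lam * ε)
  · rw [indicator_of_mem hx]
    have h2 : annularCutoff ε Λ (r ^ 2) * (ε / r) ≤ 1 := by
      rcases le_or_gt r ε with h | h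
      · rw [annularCutoff_of_le hε (by gcongr)]
        simp
      · exact mul_le_one₀ ha1 (by positivity) ((div_le_one hr).2 h.le)
    have h3 : ((N : ℝ) - 1) * (annularCutoff ε Λ (r ^ 2) * (ε / r)) ≤ (N - 1) * 1 :=
      mul_le_mul_of_nonneg_left h2 (by linarith)
    have h4 : (if r < 2 * ε then 4 * S else 0) ≤ 4 * S := by split_ifs <;> linarith
    have h5 : 0 ≤ (N : ℝ) / lam := by positivity
    linarith
  · rw [indicator_of_notMem hx]
    rw [mem_ball_zero_iff, not_lt] at hx
    have h2 : annularCutoff ε Λ (r ^ 2) * (ε / r) ≤ 1 * (1 / lam) := by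
      refine mul_le_mul ha1 ?_ (by positivity) zero_le_one
      rw [div_le_div_iff₀ hr (by linarith)]
      linarith
    have h3 : ((N : ℝ) - 1) * (annularCutoff ε Λ (r ^ 2) * (ε / r)) ≤ (N - 1) * (1 * (1 / lam)) :=
      mul_le_mul_of_nonneg_left h2 (by linarith)
    have h4 : ¬ r < 2 * ε := by nlinarith
    rw [if_neg h4] at h1
    have h5 : 0 < 1 / lam := by positivity
    have h6 : (N : ℝ) / lam = N * (1 / lam) := by ring
    linarith

/-- A smooth cutoff to the ball of radius `2 R`. -/
noncomputable def massTest (N : ℕ) (R : ℝ) (x : EuclideanSpace ℝ (Fin N)) : ℝ :=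
  Real.smoothTransition (2 - ‖x‖ ^ 2 / R ^ 2)

theorem contDiff_massTest (R : ℝ) : ContDiff ℝ ∞ (massTest N R) :=
  Real.smoothTransition.contDiff.comp (contDiff_const.sub ((contDiff_norm_sq ℝ).div_const _))

theorem massTest_eq_zero {R : ℝ} (hR : 0 < R) {x : EuclideanSpace ℝ (Fin N)} (hx : 2 * R ≤ ‖x‖) :
    massTest N R x = 0 := by
  refine Real.smoothTransition.zero_of_nonpos ?_
  rw [sub_nonpos, le_div_iff₀ (by positivity)]
  nlinarith

theorem massTest_eq_one {R : ℝ} (hR : 0 < R) {x : EuclideanSpace ℝ (Fin N)} (hx : ‖x‖ ≤ R) :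
    massTest N R x = 1 := by
  refine Real.smoothTransition.one_of_one_le ?_
  have : ‖x‖ ^ 2 / R ^ 2 ≤ 1 := by
    rw [div_le_one (by positivity)]
    gcongr
  linarith

theorem hasCompactSupport_massTest {R : ℝ} (hR : 0 < R) : HasCompactSupport (massTest N R) := by
  refine HasCompactSupport.intro (isCompact_closedBall 0 (2 * R)) fun x hx => ?_
  rw [mem_closedBall_zero_iff, not_le] at hx
  exact massTest_eq_zero hR hx.le

/-- Beyond 2R the function is locally zero; within, |x| ≤ 2R turns the chain-rule factors into
powers of 1/R. Since R ≥ 1, the Laplacian's R⁻² is relaxed to R⁻¹. -/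
theorem norm_derivatives_massTest_le {S : ℝ} (hS : ∀ z, |deriv Real.smoothTransition z| ≤ S)
    (hS' : ∀ z, |deriv (deriv Real.smoothTransition) z| ≤ S) {R : ℝ} (hR : 1 ≤ R)
    (x : EuclideanSpace ℝ (Fin N)) :
    ‖∇ (massTest N R) x‖ ≤ 4 * S / R ∧ |Δ (massTest N R) x| ≤ (16 + 2 * N) * S / R := by
  have hR0 : 0 < R := by linarith
  have hS0 : 0 ≤ S := (abs_nonneg _).trans (hS 0)
  have hinner : ∀ s, HasDerivAt (fun s => 2 - s / R ^ 2) (-(1 / R ^ 2)) s := fun s =>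
    ((hasDerivAt_id s).div_const _).const_sub _
  have hd1 : ∀ s, HasDerivAt (fun s => Real.smoothTransition (2 - s / R ^ 2))
      (deriv Real.smoothTransition (2 - s / R ^ 2) * -(1 / R ^ 2)) s := fun s =>
    HasDerivAt.comp (h₂ := Real.smoothTransition) s ((Real.smoothTransition.contDiff
      (n := 1)).differentiable (by norm_num) (2 - s / R ^ 2)).hasDerivAt (hinner s)
  have hd2 : ∀ s, HasDerivAt (fun s => deriv Real.smoothTransition (2 - s / R ^ 2) * -(1 / R ^ 2))
      (deriv (deriv Real.smoothTransition) (2 - s / R ^ 2) * -(1 / R ^ 2) * -(1 / R ^ 2)) s :=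
    fun s => (HasDerivAt.comp (h₂ := deriv Real.smoothTransition) s
      (contDiff_deriv_smoothTransition.differentiable (by norm_num)
        (2 - s / R ^ 2)).hasDerivAt (hinner s)).mul_const _
  have hg : ∇ (massTest N R) x = _ := gradient_comp_norm_sq (hd1 (‖x‖ ^ 2))
  have hl : Δ (massTest N R) x = _ := laplacian_comp_norm_sq
    (Real.smoothTransition.contDiff.comp (contDiff_const.sub (contDiff_id.div_const _))) hd1 hd2 x
  rcases lt_or_ge (2 * R) ‖x‖ with hx | hx
  · have h0 : massTest N R =ᶠ[𝓝 x] fun _ => 0 := by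
      filter_upwards [(isOpen_lt continuous_const continuous_norm).mem_nhds hx] with y hy
      exact massTest_eq_zero hR0 (le_of_lt hy)
    constructor
    · rw [h0.gradient_eq, gradient_fun_const, norm_zero]
      positivity
    · rw [(InnerProductSpace.laplacian_congr_nhds h0).eq_of_nhds, InnerProductSpace.laplacian_const]
      simp
      positivity
  · constructor
    · rw [hg, norm_smul, norm_mul, norm_mul, norm_neg, norm_div]
      simp only [Real.norm_eq_abs, abs_two, abs_one, abs_pow, abs_of_pos hR0]
      calc _ ≤ 2 * (S * (1 / R ^ 2)) * (2 * R) := by gcongr; exact hS _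
        _ = _ := by field_simp; ring
    · rw [hl]
      have e1 : |4 * ‖x‖ ^ 2 * (deriv (deriv Real.smoothTransition) (2 - ‖x‖ ^ 2 / R ^ 2) *
          -(1 / R ^ 2) * -(1 / R ^ 2))| ≤ 16 * S / R := by
        simp only [abs_mul, abs_neg, abs_div, abs_one, abs_pow, abs_of_pos hR0, abs_norm, Nat.abs_ofNat]
        calc _ ≤ 4 * (2 * R) ^ 2 * (S * (1 / R ^ 2) * (1 / R ^ 2)) := by gcongr; exact hS' _
          _ = 16 * S / R * (1 / R) := by field_simp; ring
          _ ≤ 16 * S / R * 1 := by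
            gcongr
            rwa [div_le_one hR0]
          _ = _ := mul_one _
      have e2 : |2 * (N : ℝ) * (deriv Real.smoothTransition (2 - ‖x‖ ^ 2 / R ^ 2) *
          -(1 / R ^ 2))| ≤ 2 * N * S / R := by
        simp only [abs_mul, abs_neg, abs_div, abs_one, abs_pow, abs_of_pos hR0, Nat.abs_ofNat, Nat.abs_cast]
        calc _ ≤ 2 * (N : ℝ) * (S * (1 / R ^ 2)) := by gcongr; exact hS _
          _ = 2 * N * S / R * (1 / R) := by field_simp
          _ ≤ 2 * N * S / R * 1 := by
            gcongr
            rwa [div_le_one hR0]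
          _ = _ := mul_one _
      calc _ ≤ _ := abs_add_le _ _
        _ ≤ _ := add_le_add e1 e2
        _ = _ := by ring

end TestFunction

/-! ### Boundedness and linearity of the velocity field. -/

section Drift

variable {N : ℕ} {k : ℝ → ℝ} {v w : EuclideanSpace ℝ (Fin N) → ℝ}

theorem integrable_smul_kernelGradient (hk : IsMildlySingularProfile N k) (hv : Integrable v)
    (x : EuclideanSpace ℝ (Fin N)) : Integrable fun y => v y • kernelGradient N k (x - y) :=
  hv.smul_bdd (supNormDeriv k) (measurable_kernelGradient.comp
    (measurable_const.sub measurable_id)).aestronglyMeasurable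
    (ae_of_all _ fun y => norm_kernelGradient_le hk (x - y))

theorem norm_drift_le (hN : 1 ≤ N) (hk : IsMildlySingularProfile N k) (hv : Integrable v)
    (x : EuclideanSpace ℝ (Fin N)) :
    ‖drift (radialKernel N k) v x‖ ≤ supNormDeriv k * ∫ y, |v y| := by
  rw [drift_eq_integral_kernelGradient hN hk, ← integral_const_mul]
  refine norm_integral_le_of_norm_le (hv.abs.const_mul _) (ae_of_all _ fun y => ?_)
  rw [norm_smul, Real.norm_eq_abs, mul_comm]
  exact mul_le_mul_of_nonneg_right (norm_kernelGradient_le hk _) (abs_nonneg _)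

theorem drift_sub (hN : 1 ≤ N) (hk : IsMildlySingularProfile N k) (hv : Integrable v)
    (hw : Integrable w) (x : EuclideanSpace ℝ (Fin N)) :
    drift (radialKernel N k) v x - drift (radialKernel N k) w x =
      drift (radialKernel N k) (fun y => v y - w y) x := by
  simp only [drift_eq_integral_kernelGradient hN hk, sub_smul]
  rw [integral_sub (integrable_smul_kernelGradient hk hv x) (integrable_smul_kernelGradient hk hw x)]

theorem aestronglyMeasurable_drift (hN : 1 ≤ N) (hk : IsMildlySingularProfile N k)
    (hv : Integrable v) : AEStronglyMeasurable (drift (radialKernel N k) v) volume := by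
  rw [funext fun x => drift_eq_integral_kernelGradient hN hk v x]
  refine AEStronglyMeasurable.integral_prod_right'
    (f := fun p : EuclideanSpace ℝ (Fin N) × EuclideanSpace ℝ (Fin N) =>
      v p.2 • kernelGradient N k (p.1 - p.2)) ?_
  exact hv.aestronglyMeasurable.comp_snd.smul (measurable_kernelGradient.comp
    (measurable_fst.sub measurable_snd)).aestronglyMeasurable

end Drift

/-! ### Time continuity and mass conservation. -/

section Solution

variable {N : ℕ} {k : ℝ → ℝ} {ε : ℝ} {u₀ : EuclideanSpace ℝ (Fin N) → ℝ}
  {u : ℝ → EuclideanSpace ℝ (Fin N) → ℝ}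

/-- The weight may depend on the solution, as the drift does: a bound and a Lipschitz estimate in L¹
suffice, after splitting the difference of products. -/
theorem IsGlobalSolution.continuousOn_integral_mul
    (h : IsGlobalSolution ε (radialKernel N k) u₀ u)
    {φ : ℝ → EuclideanSpace ℝ (Fin N) → ℝ} {C D : ℝ}
    (hm : ∀ t, 0 ≤ t → AEStronglyMeasurable (φ t) volume)
    (hb : ∀ t, 0 ≤ t → ∀ x, |φ t x| ≤ C + D * ∫ y, |u t y|)
    (hd : ∀ s t, 0 ≤ s → 0 ≤ t → ∀ x, |φ s x - φ t x| ≤ D * ∫ y, |u s y - u t y|) :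
    ContinuousOn (fun t => ∫ x, u t x * φ t x) (Ici 0) := by
  intro t ht
  have ht' : 0 ≤ t := ht
  have hmul : ∀ r s, 0 ≤ r → 0 ≤ s → Integrable fun x => u r x * φ s x := fun r s hr hs =>
    (h.integrable r hr).mul_bdd (hm s hs) (ae_of_all _ (hb s hs))
  rw [ContinuousWithinAt, tendsto_iff_norm_sub_tendsto_zero]
  have hδ := h.continuous_L1 t ht
  have hlim : Tendsto (fun s => (∫ x, |u s x - u t x|) * (C + D * ∫ y, |u t y|) +
      (∫ y, |u s y|) * (D * ∫ y, |u s y - u t y|)) (𝓝[Ici 0] t) (𝓝 0) := by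
    have h1 : Tendsto (fun s => ∫ y, |u s y|) (𝓝[Ici 0] t) (𝓝 (∫ y, |u t y|)) := by
      rw [tendsto_iff_norm_sub_tendsto_zero]
      refine squeeze_zero' (Eventually.of_forall fun _ => norm_nonneg _) ?_ hδ
      filter_upwards [self_mem_nhdsWithin] with s hs
      rw [← integral_sub (h.integrable s hs).abs (h.integrable t ht).abs]
      refine norm_integral_le_of_norm_le ((h.integrable s hs).sub (h.integrable t ht)).abs
        (ae_of_all _ fun x => ?_)
      exact abs_abs_sub_abs_le_abs_sub (u s x) (u t x)
    have h2 := (hδ.mul_const (C + D * ∫ y, |u t y|)).add (h1.mul (hδ.const_mul D))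
    simpa using h2
  refine squeeze_zero' (Eventually.of_forall fun _ => norm_nonneg _) ?_ hlim
  filter_upwards [self_mem_nhdsWithin] with s hs
  have hs' : 0 ≤ s := hs
  have hi1 : Integrable fun x => |u s x - u t x| * (C + D * ∫ y, |u t y|) :=
    ((h.integrable s hs).sub (h.integrable t ht)).abs.mul_const _
  have hi2 : Integrable fun x => |u s x| * (D * ∫ y, |u s y - u t y|) :=
    (h.integrable s hs).abs.mul_const _
  rw [← integral_sub (hmul s s hs hs) (hmul t t ht ht), ← integral_mul_const,
    ← integral_mul_const, ← integral_add hi1 hi2]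
  refine norm_integral_le_of_norm_le (hi1.add hi2) (ae_of_all _ fun x => ?_)
  rw [Real.norm_eq_abs, show u s x * φ s x - u t x * φ t x =
    (u s x - u t x) * φ t x + u s x * (φ s x - φ t x) by ring]
  refine (abs_add_le _ _).trans ?_
  rw [abs_mul, abs_mul]
  exact add_le_add (mul_le_mul_of_nonneg_left (hb t ht x) (abs_nonneg _))
    (mul_le_mul_of_nonneg_left (hd s t hs ht x) (abs_nonneg _))

theorem IsGlobalSolution.continuousOn_integral_mul_const
    (h : IsGlobalSolution ε (radialKernel N k) u₀ u)
    {φ : EuclideanSpace ℝ (Fin N) → ℝ} {C : ℝ} (hm : AEStronglyMeasurable φ volume)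
    (hb : ∀ x, |φ x| ≤ C) : ContinuousOn (fun t => ∫ x, u t x * φ x) (Ici 0) := by
  refine h.continuousOn_integral_mul (φ := fun _ => φ) (C := C) (D := 0) (fun _ _ => hm) ?_ ?_
  · intro t _ x
    simpa using hb x
  · intro s t _ _ x
    simp

theorem measurable_gradient (φ : EuclideanSpace ℝ (Fin N) → ℝ) : Measurable (∇ φ) := by
  unfold gradient
  exact (LinearIsometryEquiv.continuous _).measurable.comp (measurable_fderiv ℝ φ)

theorem abs_flux_le (hN : 1 ≤ N) (hk : IsMildlySingularProfile N k)
    {v : EuclideanSpace ℝ (Fin N) → ℝ} (hv : Integrable v) (hε : 0 ≤ ε)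
    {φ : EuclideanSpace ℝ (Fin N) → ℝ} {B G : ℝ} (hB : ∀ x, |Δ φ x| ≤ B) (hG : ∀ x, ‖∇ φ x‖ ≤ G)
    (x : EuclideanSpace ℝ (Fin N)) :
    |ε * Δ φ x + inner ℝ (drift (radialKernel N k) v x) (∇ φ x)| ≤
      ε * B + supNormDeriv k * G * ∫ y, |v y| := by
  refine (abs_add_le _ _).trans (add_le_add ?_ ?_)
  · rw [abs_mul, abs_of_nonneg hε]
    exact mul_le_mul_of_nonneg_left (hB x) hε
  · calc _ ≤ _ := abs_real_inner_le_norm _ _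
      _ ≤ (supNormDeriv k * ∫ y, |v y|) * G := by
        have := hk.supNormDeriv_pos
        have h2 : 0 ≤ ∫ y, |v y| := integral_nonneg fun _ => abs_nonneg _
        exact mul_le_mul (norm_drift_le hN hk hv x) (hG x) (norm_nonneg _) (by positivity)
      _ = _ := by ring

theorem aestronglyMeasurable_flux (hN : 1 ≤ N) (hk : IsMildlySingularProfile N k)
    {v : EuclideanSpace ℝ (Fin N) → ℝ} (hv : Integrable v)
    {φ : EuclideanSpace ℝ (Fin N) → ℝ} (hΔ : Continuous (Δ φ)) :
    AEStronglyMeasurable (fun x => ε * Δ φ x + inner ℝ (drift (radialKernel N k) v x) (∇ φ x))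
      volume :=
  (hΔ.aestronglyMeasurable.const_mul ε).add ((aestronglyMeasurable_drift hN hk hv).inner
    (measurable_gradient φ).aestronglyMeasurable)

theorem IsGlobalSolution.continuousOn_flux (h : IsGlobalSolution ε (radialKernel N k) u₀ u)
    (hN : 1 ≤ N) (hk : IsMildlySingularProfile N k) (hε : 0 ≤ ε)
    {φ : EuclideanSpace ℝ (Fin N) → ℝ} (hΔ : Continuous (Δ φ))
    {B G : ℝ} (hB : ∀ x, |Δ φ x| ≤ B) (hG : ∀ x, ‖∇ φ x‖ ≤ G) :
    ContinuousOn (fun t => ∫ x, u t x *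
      (ε * Δ φ x + inner ℝ (drift (radialKernel N k) (u t) x) (∇ φ x))) (Ici 0) := by
  refine h.continuousOn_integral_mul
    (φ := fun t x => ε * Δ φ x + inner ℝ (drift (radialKernel N k) (u t) x) (∇ φ x))
    (fun t ht => aestronglyMeasurable_flux hN hk (h.integrable t ht) hΔ)
    (fun t ht x => abs_flux_le hN hk (h.integrable t ht) hε hB hG x) fun s t hs ht x => ?_
  rw [add_sub_add_left_eq_sub, ← inner_sub_left, drift_sub hN hk (h.integrable s hs)
    (h.integrable t ht)]
  -- The diffusion parts cancel and the drift is linear in the density, so the flux bound with ε = 0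
  -- applies to the difference.
  have h1 := abs_flux_le (ε := 0) hN hk ((h.integrable s hs).sub (h.integrable t ht)) le_rfl
    hB hG x
  rw [zero_mul, zero_mul, zero_add, zero_add] at h1
  exact h1

theorem continuous_laplacian {φ : EuclideanSpace ℝ (Fin N) → ℝ} (hφ : ContDiff ℝ ∞ φ) :
    Continuous (Δ φ) := by
  rw [InnerProductSpace.laplacian_eq_iteratedFDeriv_stdOrthonormalBasis]
  have := hφ.continuous_iteratedFDeriv (m := 2) (by norm_cast)
  fun_prop

/-- Testing with a cutoff at radius R, the flux is O(1/R) because the L¹ norm is bounded on [0, t]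
and the drift is bounded; then R → ∞. -/
theorem IsGlobalSolution.mass_eq (h : IsGlobalSolution ε (radialKernel N k) u₀ u)
    (hN : 1 ≤ N) (hk : IsMildlySingularProfile N k) (hε : 0 ≤ ε) {t : ℝ} (ht : 0 ≤ t) :
    ∫ x, u t x = ∫ x, u₀ x := by
  obtain ⟨S, hS0, hS, hS'⟩ := exists_bound_deriv_smoothTransition
  have hu₀ : Integrable u₀ := (h.integrable 0 le_rfl).congr h.initial
  have hcont : ContinuousOn (fun s => ∫ x, |u s x|) (Icc 0 t) := by
    intro s hs
    have hs0 : 0 ≤ s := hs.1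
    refine ContinuousWithinAt.mono (t := Ici 0) ?_ Icc_subset_Ici_self
    rw [ContinuousWithinAt, tendsto_iff_norm_sub_tendsto_zero]
    refine squeeze_zero' (Eventually.of_forall fun _ => norm_nonneg _) ?_ (h.continuous_L1 s hs0)
    filter_upwards [self_mem_nhdsWithin] with r hr
    rw [← integral_sub (h.integrable r hr).abs (h.integrable s hs0).abs]
    exact norm_integral_le_of_norm_le ((h.integrable r hr).sub (h.integrable s hs0)).abs
      (ae_of_all _ fun x => abs_abs_sub_abs_le_abs_sub (u r x) (u s x))
  obtain ⟨A, hA⟩ := isCompact_Icc.exists_bound_of_continuousOn hcont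
  have hA' : ∀ s ∈ Icc 0 t, ∫ x, |u s x| ≤ A := fun s hs => (le_abs_self _).trans (hA s hs)
  have hA0 : 0 ≤ A := (integral_nonneg fun _ => abs_nonneg _).trans (hA' 0 ⟨le_rfl, ht⟩)
  have hL := hk.supNormDeriv_pos
  set Q := (A * (ε * ((16 + 2 * N) * S) + supNormDeriv k * (4 * S) * A)) * t with hQ
  have hest : ∀ R : ℝ, 1 ≤ R →
      |(∫ x, u t x * massTest N R x) - ∫ x, u₀ x * massTest N R x| ≤ Q * R⁻¹ := by
    intro R hR
    have hR0 : 0 < R := by linarith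
    rw [h.equation _ (contDiff_massTest R) (hasCompactSupport_massTest hR0) t ht,
      add_sub_cancel_left]
    have hbd : ∀ s ∈ uIoc 0 t, ‖∫ x, u s x * (ε * Δ (massTest N R) x +
        inner ℝ (drift (radialKernel N k) (u s) x) (∇ (massTest N R) x))‖ ≤
        A * (ε * ((16 + 2 * N) * S / R) + supNormDeriv k * (4 * S / R) * A) := by
      intro s hs
      rw [uIoc_of_le ht] at hs
      have hi := h.integrable s hs.1.le
      have hAs := hA' s ⟨hs.1.le, hs.2⟩
      calc _ ≤ ∫ x, |u s x| * (ε * ((16 + 2 * N) * S / R) + supNormDeriv k * (4 * S / R) * A) := by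
            refine norm_integral_le_of_norm_le (hi.abs.mul_const _) (ae_of_all _ fun x => ?_)
            rw [norm_mul]
            refine mul_le_mul_of_nonneg_left ?_ (abs_nonneg _)
            refine (abs_flux_le hN hk hi hε (fun x => (norm_derivatives_massTest_le hS hS' hR x).2)
              (fun x => (norm_derivatives_massTest_le hS hS' hR x).1) x).trans ?_
            gcongr
        _ = (∫ x, |u s x|) * (ε * ((16 + 2 * N) * S / R) + supNormDeriv k * (4 * S / R) * A) :=
            integral_mul_const _ _
        _ ≤ _ := mul_le_mul_of_nonneg_right hAs (by positivity)
    have := intervalIntegral.norm_integral_le_of_norm_le_const hbd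
    refine this.trans_eq ?_
    rw [sub_zero, abs_of_nonneg ht, hQ]
    field_simp
  have hlim : ∀ v : EuclideanSpace ℝ (Fin N) → ℝ, Integrable v →
      Tendsto (fun R => ∫ x, v x * massTest N R x) atTop (𝓝 (∫ x, v x)) := by
    intro v hv
    refine tendsto_integral_filter_of_dominated_convergence (fun x => |v x|) ?_ ?_ hv.abs ?_
    · exact Eventually.of_forall fun R => hv.aestronglyMeasurable.mul
        (contDiff_massTest R).continuous.aestronglyMeasurable
    · refine Eventually.of_forall fun R => ae_of_all _ fun x => ?_
      rw [norm_mul, massTest, Real.norm_of_nonneg (Real.smoothTransition.nonneg _)]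
      exact mul_le_of_le_one_right (norm_nonneg _) (Real.smoothTransition.le_one _)
    · refine ae_of_all _ fun x => tendsto_const_nhds.congr' ?_
      filter_upwards [eventually_ge_atTop (‖x‖ + 1)] with R hR
      rw [massTest_eq_one (by linarith [norm_nonneg x]) (by linarith), mul_one]
  have h1 := ((hlim _ (h.integrable t ht)).sub (hlim _ hu₀)).abs
  have h2 : Tendsto (fun R : ℝ => Q * R⁻¹) atTop (𝓝 0) := by
    simpa using tendsto_inv_atTop_zero.const_mul Q
  have h3 := le_of_tendsto_of_tendsto h1 h2
    ((eventually_ge_atTop 1).mono fun R hR => hest R hR)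
  exact sub_eq_zero.1 (abs_eq_zero.1 (le_antisymm h3 (abs_nonneg _)))

end Solution

/-! ### The integral inequality and Hölder on a ball. -/

section Analysis

/-- Otherwise C∫F stays below η/4. While m ≤ b - η/2 the remaining drift is at most -Aη/4, so m(t) ≤
b - 3η/4 - Aηt/4. This prevents m from reaching b - η/2 and makes m(T) negative. -/
theorem le_integral_of_integral_inequality {m F : ℝ → ℝ} {T A C η b m₀ : ℝ}
    (hA : 0 < A) (hC : 0 < C) (hη : 0 < η) (hT : 0 ≤ T)
    (hm : ContinuousOn m (Icc 0 T)) (hF : ContinuousOn F (Icc 0 T))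
    (hm0 : ∀ t ∈ Icc 0 T, 0 ≤ m t) (hF0 : ∀ t ∈ Icc 0 T, 0 ≤ F t) (hb : m₀ ≤ b - η)
    (hTb : 4 * b ≤ A * η * T)
    (hineq : ∀ t ∈ Icc 0 T, m t ≤ m₀ + ∫ s in (0 : ℝ)..t, (A * (m s - b) + A * η / 4 + C * F s)) :
    η / (4 * C) ≤ ∫ t in (0 : ℝ)..T, F t := by
  by_contra! hlt
  have hFle : ∀ t ∈ Icc 0 T, C * ∫ s in (0 : ℝ)..t, F s ≤ η / 4 := by
    intro t ht
    have h1 : ∫ s in (0 : ℝ)..t, F s ≤ ∫ s in (0 : ℝ)..T, F s := by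
      refine intervalIntegral.integral_mono_interval le_rfl ht.1 ht.2 ?_
        (hF.intervalIntegrable_of_Icc hT)
      exact (ae_restrict_iff' measurableSet_Ioc).2
        (ae_of_all _ fun s hs => hF0 s (Ioc_subset_Icc_self hs))
    have h2 : C * ∫ s in (0 : ℝ)..t, F s ≤ C * (η / (4 * C)) :=
      mul_le_mul_of_nonneg_left (h1.trans hlt.le) hC.le
    refine h2.trans_eq ?_
    field_simp
  have hstep : ∀ t ∈ Icc 0 T, (∀ s ∈ Ioo 0 t, m s ≤ b - η / 2) →
      m t ≤ b - 3 * η / 4 - A * η / 4 * t := by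
    intro t ht hs
    have hsub : Icc 0 t ⊆ Icc 0 T := Icc_subset_Icc_right ht.2
    have hmi := (hm.mono hsub).intervalIntegrable_of_Icc (μ := volume) ht.1
    have hFi := (hF.mono hsub).intervalIntegrable_of_Icc (μ := volume) ht.1
    have hi1 : IntervalIntegrable (fun s => A * (m s - b) + A * η / 4 + C * F s) volume 0 t :=
      (((hmi.sub intervalIntegrable_const).const_mul A).add intervalIntegrable_const).add
        (hFi.const_mul C)
    have hi2 : IntervalIntegrable (fun s => -(A * η / 4) + C * F s) volume 0 t :=
      intervalIntegrable_const.add (hFi.const_mul C)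
    have h1 : ∫ s in (0 : ℝ)..t, (A * (m s - b) + A * η / 4 + C * F s) ≤
        ∫ s in (0 : ℝ)..t, (-(A * η / 4) + C * F s) := by
      refine intervalIntegral.integral_mono_on_of_le_Ioo ht.1 hi1 hi2 fun s hs' => ?_
      have := mul_le_mul_of_nonneg_left (hs s hs') hA.le
      linarith
    rw [intervalIntegral.integral_add intervalIntegrable_const (hFi.const_mul C),
      intervalIntegral.integral_const, intervalIntegral.integral_const_mul, sub_zero,
      smul_eq_mul] at h1
    have h2 := hFle t ht
    have h3 := hineq t ht
    linarith
  have hall : ∀ t ∈ Icc 0 T, m t < b - η / 2 := by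
    by_contra! hne
    set B := {t ∈ Icc 0 T | b - η / 2 ≤ m t} with hB
    have hBc : IsCompact B := by
      have : IsClosed (Icc 0 T ∩ m ⁻¹' Ici (b - η / 2)) :=
        hm.preimage_isClosed_of_isClosed isClosed_Icc isClosed_Ici
      exact isCompact_Icc.of_isClosed_subset this fun x hx => hx.1
    obtain ⟨t, ht1, ht2⟩ := hne
    -- The first time at which m reaches b - η/2; `hstep` needs the bound only strictly before it.
    obtain ⟨t₀, ht₀, hmin⟩ := hBc.exists_isLeast ⟨t, ht1, ht2⟩
    have h1 := hstep t₀ ht₀.1 fun s hs => by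
      by_contra! hs'
      exact absurd (hmin ⟨⟨hs.1.le, hs.2.le.trans ht₀.1.2⟩, hs'.le⟩) (not_le.2 hs.2)
    have h2 := ht₀.2
    have h3 : 0 ≤ A * η / 4 * t₀ := mul_nonneg (by positivity) ht₀.1.1
    linarith
  have h1 := hstep T ⟨hT, le_rfl⟩ fun s hs => (hall s ⟨hs.1.le, hs.2.le⟩).le
  have h2 := hm0 T ⟨hT, le_rfl⟩
  linarith

/-- Hölder between L¹ and L^p on the ball; membership in L^p is not needed, as the right side may be
infinite. -/
theorem ofReal_setIntegral_ball_le {N : ℕ} {v : EuclideanSpace ℝ (Fin N) → ℝ} (hv : Integrable v)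
    (h0 : 0 ≤ᵐ[volume] v) {r p : ℝ} (hr : 0 < r) (hp : 1 ≤ p) :
    ENNReal.ofReal ((∫ x in Metric.ball 0 r, v x) /
      (volume.real (Metric.ball (0 : EuclideanSpace ℝ (Fin N)) r)) ^ (1 - 1 / p)) ≤
      eLpNorm v (ENNReal.ofReal p) (volume.restrict (Metric.ball 0 r)) := by
  have hb0 : 0 < volume.real (Metric.ball (0 : EuclideanSpace ℝ (Fin N)) r) :=
    ENNReal.toReal_pos (Metric.measure_ball_pos volume _ hr).ne' measure_ball_lt_top.ne
  have hvol : volume (Metric.ball (0 : EuclideanSpace ℝ (Fin N)) r) =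
      ENNReal.ofReal (volume.real (Metric.ball (0 : EuclideanSpace ℝ (Fin N)) r)) :=
    (ENNReal.ofReal_toReal measure_ball_lt_top.ne).symm
  have h := eLpNorm_le_eLpNorm_mul_rpow_measure_univ (p := 1) (q := ENNReal.ofReal p)
    (μ := volume.restrict (Metric.ball 0 r)) (f := v)
    (by rw [← ENNReal.ofReal_one]; exact ENNReal.ofReal_le_ofReal hp)
    hv.aestronglyMeasurable.restrict
  rw [Measure.restrict_apply_univ, ENNReal.toReal_ofReal (by linarith), ENNReal.toReal_one,
    div_one, hvol, ENNReal.ofReal_rpow_of_pos hb0, eLpNorm_one_eq_lintegral_enorm] at h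
  have h1 : ENNReal.ofReal (∫ x in Metric.ball 0 r, v x) =
      ∫⁻ x in Metric.ball 0 r, ‖v x‖ₑ := by
    rw [ofReal_integral_eq_lintegral_ofReal hv.integrableOn (ae_restrict_of_ae h0)]
    refine lintegral_congr_ae (ae_restrict_of_ae ?_)
    filter_upwards [h0] with x hx
    rw [Real.enorm_of_nonneg hx]
  rw [← h1] at h
  rw [ENNReal.ofReal_div_of_pos (by positivity)]
  exact ENNReal.div_le_of_le_mul h

end Analysis

/-! ### The differential inequality for the truncated moment. -/

section MomentInequality

variable {N : ℕ} {k : ℝ → ℝ}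

/-- The truncated first moment of the density `v`. -/
noncomputable def truncatedMoment (ε Λ : ℝ) (v : EuclideanSpace ℝ (Fin N) → ℝ) : ℝ :=
  ∫ x, v x * truncatedRadius ε Λ ‖x‖

theorem integrable_mul_truncatedRadius {v : EuclideanSpace ℝ (Fin N) → ℝ} (hv : Integrable v)
    {ε Λ : ℝ} (hΛ : 0 < Λ) : Integrable fun x => v x * truncatedRadius ε Λ ‖x‖ := by
  refine hv.mul_bdd (c := Λ) ?_ (ae_of_all _ fun x => ?_)
  · exact (monotone_truncatedRadius.measurable.comp measurable_norm).aestronglyMeasurable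
  · rw [Real.norm_of_nonneg (truncatedRadius_nonneg (norm_nonneg x))]
    exact (truncatedRadius_le_min hΛ (norm_nonneg x)).trans (min_le_right _ _)

theorem integral_mul_momentTest {v : EuclideanSpace ℝ (Fin N) → ℝ} (hv : Integrable v)
    {ε Λ : ℝ} (hΛ : 0 < Λ) : ∫ x, v x * momentTest N ε Λ x =
      truncatedRadius ε Λ Λ * (∫ x, v x) - truncatedMoment ε Λ v := by
  rw [truncatedMoment, ← integral_const_mul,
    ← integral_sub (hv.const_mul _) (integrable_mul_truncatedRadius hv hΛ)]
  refine integral_congr_ae (ae_of_all _ fun x => ?_)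
  simp only [momentTest, Real.sqrt_sq (norm_nonneg x)]
  ring

theorem integral_mul_indicator_ball (v : EuclideanSpace ℝ (Fin N) → ℝ) (r : ℝ) :
    ∫ x, v x * (Metric.ball 0 r).indicator (fun _ => (1 : ℝ)) x = ∫ x in Metric.ball 0 r, v x := by
  rw [← integral_indicator Metric.isOpen_ball.measurableSet]
  refine integral_congr_ae (ae_of_all _ fun x => ?_)
  by_cases hx : x ∈ Metric.ball (0 : EuclideanSpace ℝ (Fin N)) r
  · simp only [indicator_of_mem hx, mul_one]
  · simp only [indicator_of_notMem hx, mul_zero]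

theorem integrable_mul_indicator_ball {v : EuclideanSpace ℝ (Fin N) → ℝ} (hv : Integrable v)
    (r : ℝ) : Integrable fun x => v x * (Metric.ball 0 r).indicator (fun _ => (1 : ℝ)) x := by
  refine hv.mul_bdd (c := 1)
    (measurable_const.indicator Metric.isOpen_ball.measurableSet).aestronglyMeasurable
    (ae_of_all _ fun x => ?_)
  refine (norm_indicator_le_norm_self _ _).trans ?_
  simp

/-- Chebyshev: the truncated radius is at least Λ/2 - 2ε off B_{Λ/2}. -/
theorem mass_outside_ball_le {v : EuclideanSpace ℝ (Fin N) → ℝ} (hv : Integrable v)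
    (h0 : 0 ≤ᵐ[volume] v) {ε Λ : ℝ} (hε : 0 < ε) (hΛ : 0 < Λ) :
    (Λ / 2 - 2 * ε) * ((∫ x, v x) - ∫ x in Metric.ball 0 (Λ / 2), v x) ≤
      truncatedMoment ε Λ v := by
  rw [← integral_mul_indicator_ball, ← integral_sub hv (integrable_mul_indicator_ball hv _),
    ← integral_const_mul, truncatedMoment]
  refine integral_mono_ae ((hv.sub (integrable_mul_indicator_ball hv _)).const_mul _)
    (integrable_mul_truncatedRadius hv hΛ) ?_
  filter_upwards [h0] with x hx
  by_cases hxb : x ∈ Metric.ball (0 : EuclideanSpace ℝ (Fin N)) (Λ / 2)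
  · simp only [indicator_of_mem hxb, mul_one, sub_self, mul_zero]
    exact mul_nonneg hx (truncatedRadius_nonneg (norm_nonneg x))
  · simp only [indicator_of_notMem hxb, mul_zero, sub_zero]
    rw [mul_comm]
    rw [mem_ball_zero_iff, not_lt] at hxb
    exact mul_le_mul_of_nonneg_left (le_truncatedRadius hε hΛ hxb) hx

theorem virial_density_le (hN : 1 ≤ N) (hk : IsMildlySingularProfile N k)
    {v : EuclideanSpace ℝ (Fin N) → ℝ} (hv : Integrable v) (h0 : 0 ≤ᵐ[volume] v)
    (hr : IsRadial v) {ε Λ lam : ℝ} (hε : 0 < ε) (hΛ : 0 < Λ) (hlam : 2 ≤ lam) :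
    ∫ x, v x * inner ℝ (drift (radialKernel N k) v x) (radialField N (annularCutoff ε Λ) x) ≤
      -(kappa k Λ / 2 + supNormDeriv k) * (∫ x in Metric.ball 0 (Λ / 2), v x) ^ 2 +
      3 * supNormDeriv k * (∫ x, v x) * (∫ x in Metric.ball 0 (lam * ε), v x) +
      supNormDeriv k * (∫ x, v x) ^ 2 := by
  have := isFiniteMeasure_densityMeasure hv
  have := isNegInvariant_densityMeasure hv hr
  have h := virial_le hk (densityMeasure v) hΛ (by positivity : 0 < lam * ε)
    (contDiff_annularCutoff ε Λ).continuous.measurable (fun _ => annularCutoff_nonneg)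
    (fun _ => annularCutoff_le_one) fun r h1 h2 => by
      have h3 : 2 * ε ≤ r := (mul_le_mul_of_nonneg_right hlam hε.le).trans h1
      exact annularCutoff_eq_one hε hΛ (by nlinarith) (by nlinarith)
  rw [densityMeasure_real hv h0 Metric.isOpen_ball.measurableSet,
    densityMeasure_real hv h0 Metric.isOpen_ball.measurableSet,
    densityMeasure_real hv h0 MeasurableSet.univ, setIntegral_univ,
    integral_densityMeasure hv h0] at h
  simpa only [integral_densityMeasure hv h0, smul_eq_mul,
    ← drift_eq_integral_kernelGradient hN hk] using h

theorem exists_bounds_momentTest {ε Λ : ℝ} (hε : 0 < ε) (hΛ : 0 < Λ) :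
    ∃ B, (∀ x, |Δ (momentTest N ε Λ) x| ≤ B) ∧ ∀ x, ‖∇ (momentTest N ε Λ) x‖ ≤ 1 := by
  have hl : HasCompactSupport (Δ (momentTest N ε Λ)) := by
    refine HasCompactSupport.intro (isCompact_closedBall 0 Λ) fun x hx => ?_
    rw [mem_closedBall_zero_iff, not_le] at hx
    have h0 : momentTest N ε Λ =ᶠ[𝓝 x] fun _ => 0 := by
      filter_upwards [(isOpen_lt continuous_const continuous_norm).mem_nhds hx] with y hy
      rw [momentTest, Real.sqrt_sq (norm_nonneg y), truncatedRadius_of_ge hΛ (le_of_lt hy),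
        sub_self]
    rw [(InnerProductSpace.laplacian_congr_nhds h0).eq_of_nhds, InnerProductSpace.laplacian_const]
    rfl
  obtain ⟨B, hB⟩ := hl.exists_bound_of_continuous (continuous_laplacian (contDiff_momentTest hε))
  refine ⟨B, hB, fun x => ?_⟩
  rw [gradient_momentTest hε, norm_neg]
  exact norm_radialField_le (fun _ => annularCutoff_nonneg) (fun _ => annularCutoff_le_one) x

/-- With q the mass outside B_{Λ/2}, expanding (M - q)² in the virial bound cancels L M² and leaves
-κM²/2 + (κ + 2L)Mq. The values of A and b are those for which this becomes A(m - b) up to O(ε). -/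
theorem neg_flux_momentTest_le (hN : 1 ≤ N) (hk : IsMildlySingularProfile N k)
    {v : EuclideanSpace ℝ (Fin N) → ℝ} (hv : Integrable v) (h0 : 0 ≤ᵐ[volume] v)
    (hr : IsRadial v) {S : ℝ} (hS : ∀ z, |deriv Real.smoothTransition z| ≤ S)
    {ε Λ lam M A b : ℝ} (hε : 0 < ε) (hΛ : 0 < Λ) (hlam : 2 ≤ lam) (hM : ∫ x, v x = M)
    (hA : A = 2 * (kappa k Λ + 2 * supNormDeriv k) * M / Λ)
    (hb : b = kappa k Λ * M / (4 * (kappa k Λ + 2 * supNormDeriv k)) * Λ) :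
    -∫ x, v x * (ε * Δ (momentTest N ε Λ) x +
        inner ℝ (drift (radialKernel N k) v x) (∇ (momentTest N ε Λ) x)) ≤
      A * (truncatedMoment ε Λ v - b) + (2 * A * ε + (3 * S * ε / Λ + N / lam)) * M +
        (4 * S + N + 3 * supNormDeriv k * M) * ∫ x in Metric.ball 0 (lam * ε), v x := by
  have hL := hk.supNormDeriv_pos
  have hκ := hk.kappa_pos Λ hΛ
  obtain ⟨B, hB, hG⟩ := exists_bounds_momentTest (N := N) hε hΛ
  have hM0 : 0 ≤ M := hM ▸ integral_nonneg_of_ae h0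
  set F := ∫ x in Metric.ball 0 (lam * ε), v x with hF
  have hΔi : Integrable fun x => v x * -(ε * Δ (momentTest N ε Λ) x) := by
    refine hv.mul_bdd (c := ε * B) ((continuous_laplacian
      (contDiff_momentTest hε)).aestronglyMeasurable.const_mul ε).neg (ae_of_all _ fun x => ?_)
    rw [norm_neg, norm_mul, Real.norm_of_nonneg hε.le]
    exact mul_le_mul_of_nonneg_left (hB x) hε.le
  have hDi : Integrable fun x => v x * inner ℝ (drift (radialKernel N k) v x)
      (radialField N (annularCutoff ε Λ) x) := by
    refine hv.mul_bdd (c := supNormDeriv k * (∫ y, |v y|) * 1)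
      ((aestronglyMeasurable_drift hN hk hv).inner (measurable_radialField
        (contDiff_annularCutoff ε Λ).continuous.measurable).aestronglyMeasurable)
      (ae_of_all _ fun x => (norm_inner_le_norm _ _).trans ?_)
    have h2 : 0 ≤ ∫ y, |v y| := integral_nonneg fun _ => abs_nonneg _
    exact mul_le_mul (norm_drift_le hN hk hv x) (norm_radialField_le
      (fun _ => annularCutoff_nonneg) (fun _ => annularCutoff_le_one) x) (norm_nonneg _)
      (by positivity)
  have hsplit : -∫ x, v x * (ε * Δ (momentTest N ε Λ) x +
        inner ℝ (drift (radialKernel N k) v x) (∇ (momentTest N ε Λ) x)) =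
      (∫ x, v x * -(ε * Δ (momentTest N ε Λ) x)) + ∫ x, v x * inner ℝ
        (drift (radialKernel N k) v x) (radialField N (annularCutoff ε Λ) x) := by
    rw [← integral_add hΔi hDi, ← integral_neg]
    refine integral_congr_ae (ae_of_all _ fun x => ?_)
    simp only [gradient_momentTest hε, inner_neg_right]
    ring
  have hfirst : ∫ x, v x * -(ε * Δ (momentTest N ε Λ) x) ≤
      (4 * S + N) * F + (3 * S * ε / Λ + N / lam) * M := by
    have hi := ((integrable_mul_indicator_ball hv (lam * ε)).const_mul (4 * S + N))
    have hi' := hv.const_mul (3 * S * ε / Λ + N / lam)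
    rw [hF, ← hM, ← integral_mul_indicator_ball, ← integral_const_mul, ← integral_const_mul,
      ← integral_add hi hi']
    refine integral_mono_ae hΔi (hi.add hi') ?_
    filter_upwards [h0] with x hx
    refine (mul_le_mul_of_nonneg_left (neg_laplacian_momentTest_le hS hN hε hΛ hlam x) hx).trans_eq
      ?_
    ring
  have hsecond := virial_density_le hN hk hv h0 hr hε hΛ hlam
  have hout := mass_outside_ball_le hv h0 hε hΛ
  have hin0 : 0 ≤ ∫ x in Metric.ball 0 (Λ / 2), v x :=
    integral_nonneg_of_ae (ae_restrict_of_ae h0)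
  rw [hM] at hsecond hout
  set q := M - ∫ x in Metric.ball 0 (Λ / 2), v x with hq
  set m := truncatedMoment ε Λ v
  have hin : ∫ x in Metric.ball 0 (Λ / 2), v x = M - q := by rw [hq]; ring
  rw [hin] at hsecond hin0
  have hAb : A * b = kappa k Λ * M ^ 2 / 2 := by
    rw [hA, hb]
    field_simp
    ring
  have hAq : (kappa k Λ + 2 * supNormDeriv k) * M * q ≤ A * (m + 2 * ε * M) := by
    -- Uses q ≤ M to replace 2εq by 2εM.
    have h1 : q * (Λ / 2) ≤ m + 2 * ε * M := by nlinarith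
    have h2 : (kappa k Λ + 2 * supNormDeriv k) * M * q = A * (q * (Λ / 2)) := by
      rw [hA]
      field_simp
    rw [h2]
    exact mul_le_mul_of_nonneg_left h1 (by rw [hA]; positivity)
  have hsq : 0 ≤ (kappa k Λ / 2 + supNormDeriv k) * q ^ 2 := by positivity
  rw [hsplit]
  have hexp : -(kappa k Λ / 2 + supNormDeriv k) * (M - q) ^ 2 + supNormDeriv k * M ^ 2 =
      -(kappa k Λ * M ^ 2 / 2) + (kappa k Λ + 2 * supNormDeriv k) * M * q -
        (kappa k Λ / 2 + supNormDeriv k) * q ^ 2 := by ring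
  linarith

theorem le_integral_mass_ball (hN : 1 ≤ N) (hk : IsMildlySingularProfile N k)
    {u₀ : EuclideanSpace ℝ (Fin N) → ℝ} {u : ℝ → EuclideanSpace ℝ (Fin N) → ℝ}
    {S : ℝ} (hS0 : 0 < S) (hS : ∀ z, |deriv Real.smoothTransition z| ≤ S)
    {ε Λ lam M A b η T : ℝ} (hε : 0 < ε) (hΛ : 0 < Λ) (hlam : 2 ≤ lam)
    (hM : ∫ x, u₀ x = M) (hM0 : 0 < M)
    (hA : A = 2 * (kappa k Λ + 2 * supNormDeriv k) * M / Λ)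
    (hb : b = kappa k Λ * M / (4 * (kappa k Λ + 2 * supNormDeriv k)) * Λ)
    (hη : 0 < η) (hη' : ∫ x, min ‖x‖ Λ * u₀ x ≤ b - η) (hT : 0 ≤ T) (hTb : 4 * b ≤ A * η * T)
    (hsmall : (2 * A * ε + (3 * S * ε / Λ + N / lam)) * M ≤ A * η / 4)
    (h : IsGlobalSolution ε (radialKernel N k) u₀ u)
    (h0 : ∀ t : ℝ, 0 ≤ t → 0 ≤ᵐ[volume] u t) (hr : ∀ t : ℝ, 0 ≤ t → IsRadial (u t)) :
    ContinuousOn (fun t => ∫ x in Metric.ball 0 (lam * ε), u t x) (Ici 0) ∧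
    η / (4 * (4 * S + N + 3 * supNormDeriv k * M)) ≤
      ∫ t in (0 : ℝ)..T, ∫ x in Metric.ball 0 (lam * ε), u t x := by
  have hL := hk.supNormDeriv_pos
  have hκ := hk.kappa_pos Λ hΛ
  have hF : ContinuousOn (fun t => ∫ x in Metric.ball 0 (lam * ε), u t x) (Ici 0) := by
    have := h.continuousOn_integral_mul_const (C := 1)
      (φ := (Metric.ball 0 (lam * ε)).indicator fun _ => (1 : ℝ))
      (measurable_const.indicator Metric.isOpen_ball.measurableSet).aestronglyMeasurable
      fun x => (norm_indicator_le_norm_self (fun _ => (1 : ℝ)) x).trans (by simp)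
    simpa only [integral_mul_indicator_ball] using this
  have hm : ContinuousOn (fun t => truncatedMoment ε Λ (u t)) (Ici 0) := by
    refine h.continuousOn_integral_mul_const (C := Λ) (φ := fun x => truncatedRadius ε Λ ‖x‖)
      (monotone_truncatedRadius.measurable.comp measurable_norm).aestronglyMeasurable fun x => ?_
    rw [abs_of_nonneg (truncatedRadius_nonneg (norm_nonneg x))]
    exact (truncatedRadius_le_min hΛ (norm_nonneg x)).trans (min_le_right _ _)
  refine ⟨hF, ?_⟩
  obtain ⟨B, hB, hG⟩ := exists_bounds_momentTest (N := N) hε hΛ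
  have hflux := h.continuousOn_flux hN hk hε.le
    (continuous_laplacian (contDiff_momentTest hε)) hB hG
  have hu₀ : Integrable u₀ := (h.integrable 0 le_rfl).congr h.initial
  have hu₀0 : 0 ≤ᵐ[volume] u₀ := by
    filter_upwards [h0 0 le_rfl, h.initial] with x h1 h2
    rwa [← h2]
  have hini : truncatedMoment ε Λ u₀ ≤ ∫ x, min ‖x‖ Λ * u₀ x := by
    rw [truncatedMoment]
    refine integral_mono_ae (integrable_mul_truncatedRadius hu₀ hΛ) ?_ ?_
    · refine hu₀.bdd_mul (c := Λ) (by fun_prop) (ae_of_all _ fun x => ?_)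
      rw [Real.norm_of_nonneg (le_min (norm_nonneg x) hΛ.le)]
      exact min_le_right _ _
    · filter_upwards [hu₀0] with x hx
      rw [mul_comm]
      exact mul_le_mul_of_nonneg_right (truncatedRadius_le_min hΛ (norm_nonneg x)) hx
  refine le_integral_of_integral_inequality (m := fun t => truncatedMoment ε Λ (u t)) (A := A)
    (b := b) (m₀ := truncatedMoment ε Λ u₀) (by rw [hA]; positivity) (by positivity) hη hT
    (hm.mono Icc_subset_Ici_self) (hF.mono Icc_subset_Ici_self) ?_ ?_ (hini.trans hη') hTb ?_
  · intro t ht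
    refine integral_nonneg_of_ae ?_
    filter_upwards [h0 t ht.1] with x hx
    exact mul_nonneg hx (truncatedRadius_nonneg (norm_nonneg x))
  · exact fun t ht => integral_nonneg_of_ae (ae_restrict_of_ae (h0 t ht.1))
  · intro t ht
    have heq := h.equation _ (contDiff_momentTest hε) (hasCompactSupport_momentTest hΛ) t ht.1
    rw [integral_mul_momentTest (h.integrable t ht.1) hΛ, integral_mul_momentTest hu₀ hΛ,
      h.mass_eq hN hk hε.le ht.1] at heq
    have heq' : truncatedMoment ε Λ (u t) = truncatedMoment ε Λ u₀ +
        ∫ s in (0 : ℝ)..t, -∫ x, u s x * (ε * Δ (momentTest N ε Λ) x +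
          inner ℝ (drift (radialKernel N k) (u s) x) (∇ (momentTest N ε Λ) x)) := by
      rw [intervalIntegral.integral_neg]
      linarith
    rw [heq']
    refine add_le_add_right ?_ _
    refine intervalIntegral.integral_mono_on ht.1
      ((hflux.neg.mono Icc_subset_Ici_self).intervalIntegrable_of_Icc ht.1) ?_ fun s hs => ?_
    · refine ContinuousOn.intervalIntegrable_of_Icc ht.1 (ContinuousOn.mono ?_ Icc_subset_Ici_self)
      fun_prop
    · have := neg_flux_momentTest_le hN hk (h.integrable s hs.1) (h0 s hs.1) (hr s hs.1) hS hε hΛ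
        hlam ((h.mass_eq hN hk hε.le hs.1).trans hM) hA hb
      linarith

end MomentInequality

/-! ### Choice of constants and conclusion. -/

theorem mainTheorem2 (N : ℕ) (hN : 1 ≤ N) (k : ℝ → ℝ) (hk : IsMildlySingularProfile N k)
    (u₀ : EuclideanSpace ℝ (Fin N) → ℝ)
    (hu₀_one : MemLp u₀ 1 volume) (hu₀_top : MemLp u₀ ⊤ volume)
    (hu₀_nonneg : 0 ≤ᵐ[volume] u₀) (hu₀_mass : 0 < ∫ x, u₀ x) (hu₀_radial : IsRadial u₀)
    (Λ : ℝ) (hΛ : 0 < Λ)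
    (hμ : ∫ x, min ‖x‖ Λ * u₀ x <
      kappa k Λ * (∫ x, u₀ x) / (4 * (kappa k Λ + 2 * supNormDeriv k)) * Λ) :
    ∃ εstar : ℝ, 0 < εstar ∧ ∃ Tstar : ℝ, 0 < Tstar ∧ ∃ lam : ℝ, 0 < lam ∧
      ∀ p : ℝ, 1 ≤ p → ∃ C : ℝ, 0 < C ∧
        ∀ ε : ℝ, 0 < ε → ε < εstar →
          ∀ u : ℝ → EuclideanSpace ℝ (Fin N) → ℝ,
            IsGlobalSolution ε (radialKernel N k) u₀ u →
            (∀ t : ℝ, 0 ≤ t → 0 ≤ᵐ[volume] u t) →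
            (∀ t : ℝ, 0 ≤ t → IsRadial (u t)) →
            ENNReal.ofReal (C * ε ^ (-((N : ℝ) * (p - 1) / p))) ≤
              ∫⁻ t in Icc 0 Tstar,
                eLpNorm (u t) (ENNReal.ofReal p)
                  (volume.restrict (Metric.ball 0 (lam * ε))) := by
  obtain ⟨S, hS0, hS, -⟩ := exists_bound_deriv_smoothTransition
  have hL := hk.supNormDeriv_pos
  have hκ := hk.kappa_pos Λ hΛ
  set M := ∫ x, u₀ x with hM
  obtain ⟨A, hA⟩ : ∃ A, A = 2 * (kappa k Λ + 2 * supNormDeriv k) * M / Λ := ⟨_, rfl⟩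
  obtain ⟨b, hb⟩ : ∃ b, b = kappa k Λ * M / (4 * (kappa k Λ + 2 * supNormDeriv k)) * Λ := ⟨_, rfl⟩
  obtain ⟨η, hη⟩ : ∃ η, η = b - ∫ x, min ‖x‖ Λ * u₀ x := ⟨_, rfl⟩
  have hA0 : 0 < A := by rw [hA]; positivity
  have hb0 : 0 < b := by rw [hb]; positivity
  have hη0 : 0 < η := by rw [hη, hb]; linarith
  have hN0 : (0 : ℝ) < N := by exact_mod_cast hN
  -- Large enough that the diffusion error NM/λ takes at most Aη/8, half of the allowed Aη/4.
  obtain ⟨lam, hlam⟩ : ∃ lam, lam = 2 + 8 * N * M / (A * η) := ⟨_, rfl⟩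
  have hlam2 : 2 ≤ lam := by
    rw [hlam]
    have : 0 < 8 * N * M / (A * η) := by positivity
    linarith
  have hlam0 : 0 < lam := by linarith
  have hNlam : N / lam * M ≤ A * η / 8 := by
    rw [div_mul_eq_mul_div, div_le_iff₀ hlam0, hlam]
    have : A * η / 8 * (2 + 8 * N * M / (A * η)) = A * η / 4 + N * M := by
      field_simp
      ring
    rw [this]
    have : 0 < A * η := by positivity
    linarith
  -- The time in which a decrease at rate Aη/4 uses up b.
  obtain ⟨T, hT⟩ : ∃ T, T = 4 * b / (A * η) := ⟨_, rfl⟩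
  have hT0 : 0 < T := by rw [hT]; positivity
  have hTb : 4 * b ≤ A * η * T := by
    rw [hT]
    exact (mul_div_cancel₀ _ (by positivity)).ge
  obtain ⟨c, hc⟩ : ∃ c, c = η / (4 * (4 * S + N + 3 * supNormDeriv k * M)) := ⟨_, rfl⟩
  have hc0 : 0 < c := by rw [hc]; positivity
  set V₀ := volume.real (Metric.ball (0 : EuclideanSpace ℝ (Fin N)) 1) with hV₀
  have hV₀pos : 0 < V₀ :=
    ENNReal.toReal_pos (Metric.measure_ball_pos volume _ one_pos).ne' measure_ball_lt_top.ne
  -- The bound on ε keeps the errors proportional to ε below the other Aη/8. Only the last constant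
  -- involves p, through the volume of the ball in Hölder.
  refine ⟨A * η / 8 / (2 * A * M + 3 * S * M / Λ), by positivity, T, hT0, lam, hlam0,
    fun p hp => ⟨c / (lam ^ N * V₀) ^ (1 - 1 / p), by positivity, ?_⟩⟩
  intro ε hε hεs u hu hu0 hur
  rw [lt_div_iff₀ (by positivity)] at hεs
  have hsmall : (2 * A * ε + (3 * S * ε / Λ + N / lam)) * M ≤ A * η / 4 := by
    have : (2 * A * ε + (3 * S * ε / Λ + N / lam)) * M =
        ε * (2 * A * M + 3 * S * M / Λ) + N / lam * M := by ring
    linarith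
  obtain ⟨hF, hle⟩ := le_integral_mass_ball hN hk hS0 hS hε hΛ hlam2 hM.symm hu₀_mass hA hb hη0
    (by rw [hη]; linarith) hT0.le hTb hsmall hu hu0 hur
  rw [← hc] at hle
  have hr0 : 0 < lam * ε := by positivity
  have hvol : volume.real (Metric.ball (0 : EuclideanSpace ℝ (Fin N)) (lam * ε)) =
      lam ^ N * V₀ * ε ^ N := by
    rw [measureReal_def, Measure.addHaar_ball_of_pos _ _ hr0, ENNReal.toReal_mul,
      ENNReal.toReal_ofReal (by positivity), finrank_euclideanSpace_fin, hV₀, measureReal_def]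
    ring
  set β := volume.real (Metric.ball (0 : EuclideanSpace ℝ (Fin N)) (lam * ε)) ^ (1 - 1 / p) with hβ
  have hβeq : β = (lam ^ N * V₀) ^ (1 - 1 / p) * ε ^ ((N : ℝ) * (p - 1) / p) := by
    rw [hβ, hvol, Real.mul_rpow (by positivity) (by positivity), ← Real.rpow_natCast ε N,
      ← Real.rpow_mul hε.le]
    congr 2
    field_simp
  have hβ0 : 0 < β := by rw [hβeq]; positivity
  calc ENNReal.ofReal (c / (lam ^ N * V₀) ^ (1 - 1 / p) * ε ^ (-((N : ℝ) * (p - 1) / p)))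
      = ENNReal.ofReal (c / β) := by
        rw [hβeq, Real.rpow_neg hε.le]
        congr 1
        field_simp
    _ ≤ ENNReal.ofReal (∫ t in Icc 0 T, (∫ x in Metric.ball 0 (lam * ε), u t x) / β) := by
        rw [integral_div, integral_Icc_eq_integral_Ioc, ← intervalIntegral.integral_of_le hT0.le]
        gcongr
    _ = ∫⁻ t in Icc 0 T, ENNReal.ofReal ((∫ x in Metric.ball 0 (lam * ε), u t x) / β) := by
        refine ofReal_integral_eq_lintegral_ofReal ?_ ?_
        · exact ((hF.mono Icc_subset_Ici_self).integrableOn_Icc).div_const β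
        · refine (ae_restrict_iff' measurableSet_Icc).2 (ae_of_all _ fun t ht => ?_)
          exact div_nonneg (integral_nonneg_of_ae (ae_restrict_of_ae (hu0 t ht.1))) hβ0.le
    _ ≤ _ := by
        refine setLIntegral_mono' measurableSet_Icc fun t ht => ?_
        exact ofReal_setIntegral_ball_le (hu.integrable t ht.1) (hu0 t ht.1) hr0 hp
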